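/- **Deterministic two-party Watson-Crick systems.** A DPWK consists of finite sets $\Sigma$ (input symbols), $M$ (messages), two endmarkers ${\vartriangleright},{\vartriangleleft}\notin\Sigma$, and two components $A_i$ ($i=1,2$), each with a finite state set $Q_i$, an initial state $q_{0,i}$, accepting states $F_i\subseteq Q_i$, a broadcast function $\mu_i:Q_i\times(\Sigma\cup\{{\vartriangleright},{\vartriangleleft}\})\to M\cup\{\bot\}$ ($\bot$: nothing is sent) and a partial transition function $\delta_i:Q_i\times(\Sigma\cup\{{\vartriangleright},{\vartriangleleft}\})\times(M\cup\{\bot\})\to Q_i\times\{0,1\}$. For an input $w=a_1\cdots a_n$ put $a_0={\vartriangleright}$, $a_{n+1}={\vartriangleleft}$. A configuration is $(p,q,i,j)$ with $p\in Q_1$, $q\in Q_2$ and head positions $0\le i,j\le n+1$; the initial one is $(q_{0,1},q_{0,2},0,n+1)$. There is a step $(p,q,i,j)\vdash(p_1,q_1,i',j')$ iff $\delta_1(p,a_i,\mu_2(q,a_j))=(p_1,d_1)$, $\delta_2(q,a_j,\mu_1(p,a_i))=(q_1,d_2)$, $i'=i+d_1$ and $j'=j-d_2$ for some $d_1,d_2$.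 A word is accepted if the computation from the initial configuration reaches a configuration without successor in which $p\in F_1$ or $q\in F_2$; the set of accepted words is the language of the system. **Reversibility.** A DPWK is reversible (a REV-PWK) if every configuration has at most one predecessor and there are reverse broadcast functions $\mu_i^{\leftarrow}$ and partial reverse transition functions $\delta_i^{\leftarrow}$, of the same types as $\mu_i,\delta_i$, such that $C\vdash C'$ holds iff $C'\vdash^{\leftarrow}C$. Here $(p_1,q_1,i',j')\vdash^{\leftarrow}(p,q,i,j)$ means that $\delta_1^{\leftarrow}(p_1,a_i,\mu_2^{\leftarrow}(q_1,a_j))=(p,d_1)$, $\delta_2^{\leftarrow}(q_1,a_j,\mu_1^{\leftarrow}(p_1,a_i))=(q,d_2)$, $i=i'-d_1$ and $j=j'+d_2$ for some $d_1,d_2$: heads move first, then the symbols at the new positions are read. **Bounded communication.** A REV-PWK (with its reverse functions) is communication bounded by $f:\mathbb N\to\mathbb N$ if, for every accepted word $w$, at most $f(|w|)$ messages are sent in total in the accepting computation on $w$ (in all its configurations, the halting one included), and at most $f(|w|)$ messages are sent in total in the reverse computation leading from its halting configuration back to the initial one. Let $\mathscr L(\text{REV-PWK}_{O(g)})$ be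 the family of all languages accepted by REV-PWKs (over arbitrary finite alphabets of symbols from a fixed infinite set) that are communication bounded by some $f\in O(g)$. **Theorem.** The following inclusions all hold and are all strict: $$\mathscr L(\text{REV-PWK}_{O(1)})\subset\mathscr L(\text{REV-PWK}_{O(\log n)})\subset\mathscr L(\text{REV-PWK}_{O(\sqrt n)})\subset\mathscr L(\text{REV-PWK}_{O(n)}).$$ -/

import Mathlib

open Filter Asymptotics

namespace WatsonCrick

/-- Contents of a tape cell: the left endmarker, the right endmarker, or an input symbol. -/
inductive TapeSym (α : Type*) where
  | left : TapeSym α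
  | right : TapeSym α
  | sym : α → TapeSym α

/-- Cell `i` of the tape for the input `w = a₁ ⋯ aₙ`: cell `0` holds the left endmarker, cell
`i` with `1 ≤ i ≤ n` holds `aᵢ`, and cell `n + 1` holds the right endmarker. -/
def tape {α : Type*} (w : List α) : ℕ → TapeSym α
  | 0 => TapeSym.left
  | i + 1 => match w[i]? with
    | some a => TapeSym.sym a
    | none => TapeSym.right

/-- Head movement: stay on the current square, or move by one square (in the direction of
travel of the component for forward steps, in the opposite direction for backward steps). -/
inductive Move where
  | stay : Move
  | step : Move

/-- The number of squares moved. -/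
def Move.dist : Move → ℕ
  | Move.stay => 0
  | Move.step => 1

/-- Deterministic two-party Watson-Crick systems over the input alphabet `α`. Index `1` is the
upper component (moving left to right), index `2` the lower one (moving right to left). A message
is an element of `Option M`, where `none` means that nothing is sent. The transition functions are
partial: `none` means undefined. -/
structure DPWK (α : Type*) where
  /-- messages -/
  M : Type
  /-- states of the upper component -/
  Q₁ : Type
  /-- states of the lower component -/
  Q₂ : Type
  finiteM : Finite M
  finiteQ₁ : Finite Q₁
  finiteQ₂ : Finite Q₂
  /-- broadcast functions -/
  μ₁ : Q₁ → TapeSym α → Option M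
  μ₂ : Q₂ → TapeSym α → Option M
  /-- transition functions: state, scanned symbol, received message -/
  δ₁ : Q₁ → TapeSym α → Option M → Option (Q₁ × Move)
  δ₂ : Q₂ → TapeSym α → Option M → Option (Q₂ × Move)
  /-- initial states -/
  start₁ : Q₁
  start₂ : Q₂
  /-- accepting states -/
  F₁ : Set Q₁
  F₂ : Set Q₂

/-- The number of messages sent, out of the two components' broadcasts (`none` is not counted). -/
def messageCount {M : Type*} (m₁ m₂ : Option M) : ℕ :=
  m₁.toList.length + m₂.toList.length

namespace DPWK

variable {α : Type*}

/-- Configurations on inputs of length `n`: the two states and the two head positions, which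
range over the cells `0, …, n + 1`. -/
@[ext]
structure Config (A : DPWK α) (n : ℕ) where
  state₁ : A.Q₁
  state₂ : A.Q₂
  head₁ : Fin (n + 2)
  head₂ : Fin (n + 2)

/-- The initial configuration: the upper component scans the left endmarker and the lower
component scans the right endmarker, both in their initial states. -/
def init (A : DPWK α) (n : ℕ) : A.Config n where
  state₁ := A.start₁
  state₂ := A.start₂
  head₁ := 0
  head₂ := Fin.last (n + 1)

/-- One computation step `C ⊢ C'` on the input `w`. -/
def Step (A : DPWK α) (w : List α) (C C' : A.Config w.length) : Prop :=
  ∃ d₁ d₂ : Move,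
    A.δ₁ C.state₁ (tape w C.head₁) (A.μ₂ C.state₂ (tape w C.head₂)) = some (C'.state₁, d₁) ∧
    A.δ₂ C.state₂ (tape w C.head₂) (A.μ₁ C.state₁ (tape w C.head₁)) = some (C'.state₂, d₂) ∧
    (C'.head₁ : ℕ) = C.head₁ + d₁.dist ∧
    (C'.head₂ : ℕ) + d₂.dist = C.head₂

/-- A configuration is halting if it has no successor. -/
def Halting (A : DPWK α) (w : List α) (C : A.Config w.length) : Prop :=
  ∀ C', ¬ A.Step w C C'

/-- At least one component is in an accepting state. -/
def Accepting (A : DPWK α) {n : ℕ} (C : A.Config n) : Prop :=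
  C.state₁ ∈ A.F₁ ∨ C.state₂ ∈ A.F₂

/-- The accepted language. -/
def language (A : DPWK α) : Language α :=
  {w | ∃ C : A.Config w.length,
    Relation.ReflTransGen (A.Step w) (A.init w.length) C ∧ A.Halting w C ∧ A.Accepting C}

/-- The number of messages sent in the configuration `C`. -/
def sent (A : DPWK α) (w : List α) (C : A.Config w.length) : ℕ :=
  messageCount (A.μ₁ C.state₁ (tape w C.head₁)) (A.μ₂ C.state₂ (tape w C.head₂))

/-- `A.Run w C k C'`: some computation leads from `C` to `C'`, and in the configurations
that precede `C'` in it `k` messages are sent in total. -/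
inductive Run (A : DPWK α) (w : List α) : A.Config w.length → ℕ → A.Config w.length → Prop
  | refl (C) : Run A w C 0 C
  | step {C C' C'' k} : A.Step w C C' → Run A w C' k C'' → Run A w C (A.sent w C + k) C''

/-- Reverse transition functions and reverse broadcast functions for a system. -/
structure Reverse (A : DPWK α) where
  μ₁ : A.Q₁ → TapeSym α → Option A.M
  μ₂ : A.Q₂ → TapeSym α → Option A.M
  δ₁ : A.Q₁ → TapeSym α → Option A.M → Option (A.Q₁ × Move)
  δ₂ : A.Q₂ → TapeSym α → Option A.M → Option (A.Q₂ × Move)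

/-- One reverse step from `C'` to `C` on the input `w`. In a reverse step a head is moved first
(the upper one to the left, the lower one to the right), and the symbol that is read is the one at
the new position. So the symbols used are those scanned in `C`, with the states of `C'`. -/
def Reverse.Step {A : DPWK α} (R : A.Reverse) (w : List α) (C' C : A.Config w.length) : Prop :=
  ∃ d₁ d₂ : Move,
    R.δ₁ C'.state₁ (tape w C.head₁) (R.μ₂ C'.state₂ (tape w C.head₂)) = some (C.state₁, d₁) ∧
    R.δ₂ C'.state₂ (tape w C.head₂) (R.μ₁ C'.state₁ (tape w C.head₁)) = some (C.state₂, d₂) ∧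
    (C.head₁ : ℕ) + d₁.dist = C'.head₁ ∧
    (C.head₂ : ℕ) = C'.head₂ + d₂.dist

/-- The number of messages sent in the reverse step from `C'` to `C`. -/
def Reverse.sent {A : DPWK α} (R : A.Reverse) (w : List α) (C' C : A.Config w.length) : ℕ :=
  messageCount (R.μ₁ C'.state₁ (tape w C.head₁)) (R.μ₂ C'.state₂ (tape w C.head₂))

/-- `R.Run w C' k C`: some reverse computation leads from `C'` to `C`, and `k` messages are sent
in it in total. -/
inductive Reverse.Run {A : DPWK α} (R : A.Reverse) (w : List α) :
    A.Config w.length → ℕ → A.Config w.length → Prop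
  | refl (C) : Reverse.Run R w C 0 C
  | step {C'' C' C k} : R.Step w C'' C' → Reverse.Run R w C' k C →
      Reverse.Run R w C'' (R.sent w C'' C' + k) C

/-- The system is reversible, as witnessed by the reverse functions `R`: every configuration has at
most one predecessor, and the relation induced by `R` is the converse of the step relation. -/
def ReversibleBy (A : DPWK α) (R : A.Reverse) : Prop :=
  (∀ (w : List α) (C₁ C₂ C' : A.Config w.length),
    A.Step w C₁ C' → A.Step w C₂ C' → C₁ = C₂) ∧
  ∀ (w : List α) (C C' : A.Config w.length), R.Step w C' C ↔ A.Step w C C'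

/-- The reversible system `A` with reverse functions `R` is communication bounded by `f`: every
accepted word `w` has an accepting computation such that at most `f |w|` messages are sent in it
(those of the halting configuration included) and at most `f |w|` messages are sent in the reverse
computation that leads from its halting configuration back to the initial one. -/
def CommBoundedBy (A : DPWK α) (R : A.Reverse) (f : ℕ → ℕ) : Prop :=
  ∀ w ∈ A.language, ∃ C : A.Config w.length, A.Halting w C ∧ A.Accepting C ∧
    (∃ k, A.Run w (A.init w.length) k C ∧ k + A.sent w C ≤ f w.length) ∧
    (∃ k, R.Run w C k (A.init w.length) ∧ k ≤ f w.length)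

end DPWK

/-- The class `O(g)` of functions `ℕ → ℕ`. -/
def bigO (g : ℕ → ℝ) : Set (ℕ → ℕ) :=
  {f | (fun n => (f n : ℝ)) =O[atTop] g}

/-- The family of languages, over finite alphabets of symbols from `S`, that are accepted by
reversible two-party Watson-Crick systems communication bounded by some `f ∈ O(g)`. The systems
have the alphabet `Γ` as set of input symbols; the accepted language is read as a set of words over
`S ⊇ Γ`. -/
def revPWKFamily (S : Type*) (g : ℕ → ℝ) : Set (Language S) :=
  {L | ∃ (Γ : Finset S) (A : DPWK Γ) (R : A.Reverse), A.ReversibleBy R ∧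
    (∃ f ∈ bigO g, A.CommBoundedBy R f) ∧ L = Language.map Subtype.val A.language}

end WatsonCrick

/-!
The separating languages consist of palindromes over blank and marked cells with a symbol in the
centre, in which the marks are rare enough. They are accepted by one system, with a parameter.

The upper component sends nothing and does all the checking. The lower one, which ignores
messages, announces a mark or a centre when its head leaves the cell. Both heads move at full
speed until they meet in the centre, and so the upper component can compare the two halves of the
input. Behind the centre the heads move apart, and the lower one is slower: depending on the
parameter `dw`, it spends two steps on each cell, or on each marked cell, or on no cell. The upper
component checks that it is never more than one mark ahead of the lower one (`Sparse`,
`mem_machine_language_iff`). If every cell takes two steps, then the distance from the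
centre at least doubles from one mark to the next, and an accepted word of length `n` has
`O(log n)` marks (`marks_le_of_sparse_always`). If only marked cells take two steps, then the gap behind the `i`-th
mark has at least about `i` cells, and there are `O(√n)` marks (`marks_le_of_sparse_id`). If no
cell does, the condition is void. Every cell is announced at most once, so the number of marks
bounds the communication. For a fixed symbol and message both transition functions are injective,
the entered state determines the move, and the message of the lower component is determined by the
state that it enters; this makes the system reversible (`machine_reversible`), and forward and
backward steps send the same messages.

For the lower bounds, let an observer record the messages with the times at which they are sent,
the states and times in which the heads cross a fixed border in the input, and which components
are blocked or accepting at the end. If two accepting computations yield the same record, then the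
left part of one input may be combined with the right part of the other one
(`mem_language_of_event_eq`). A halting computation on a word of length `n` takes `O(n ^ 2)`
steps, so for communication `f` there are at most `(K * (n + 2) ^ 2) ^ (f n + 3)` records, and no
fooling set is larger (`DPWK.exists_card_fooling_le`). Palindromes with one mark in each of `r`
windows of width `W` form a fooling set of size `W ^ r` (`pow_le_of_mem_family`). Windows of width
`2 ^ M` at exponentially growing distances give `2 ^ (M ^ 2)` words of length `2 ^ O(M)`, too many
for constant communication; `M` windows of width `2` give `2 ^ M` words of length `O(M ^ 2)` in
the second language, too many for `O(log n)`, and of length `O(M)` in the third one, too many for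
`O(√n)`.
-/

namespace WatsonCrick

/-! ### A reversible system for sparse palindromes -/

/-- The working alphabet: a cell, which is marked or blank, and the symbol for the centre. -/
inductive Letter where
  | cell : Bool → Letter
  | centre : Letter

instance : Finite Letter :=
  Finite.of_injective (β := Option Bool)
    (fun x => match x with | .cell b => some b | .centre => none) (by
      intro x y h; cases x <;> cases y <;> simp_all)

/-- States of the upper component: `scan` before the centre, `check e` behind it, where `e` tells
whether the upper component is one mark ahead of the lower one, and `done e` at the right end. -/
inductive Up where
  | scan : Up
  | check : Bool → Up
  | done : Bool → Up

instance : Finite Up :=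
  Finite.of_injective (β := Option (Bool × Bool))
    (fun x => match x with
      | .scan => none | .check b => some (b, true) | .done b => some (b, false))
    (by intro x y h; cases x <;> cases y <;> simp_all)

/-- States of the lower component: `scan` before the centre, and behind it `arrive` on the first
visit of a cell and `linger` on the second one. -/
inductive Lo where
  | scan : Lo
  | arrive : Lo
  | linger : Lo

instance : Finite Lo :=
  Finite.of_injective (β := Fin 3)
    (fun x => match x with | .scan => 0 | .arrive => 1 | .linger => 2)
    (by intro x y h; cases x <;> cases y <;> simp_all)

/-- The message that stands for a tape symbol: only marks and centres are announced. -/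
def msgOf : TapeSym Letter → Option Letter
  | .sym (.cell true) => some (.cell true)
  | .sym .centre => some .centre
  | _ => none

/-- The transition function of the upper component. In the states `check e` it keeps track of the
difference `e` between the number of marks it has read and the number it has been told about, and it
is undefined if this difference would leave `{0, 1}`. -/
def upStep : Up → TapeSym Letter → Option Letter → Option (Up × Move)
  | .scan, .left, none => some (.scan, .step)
  | .scan, .sym (.cell false), none => some (.scan, .step)
  | .scan, .sym (.cell true), some (.cell true) => some (.scan, .step)
  | .scan, .sym .centre, some .centre => some (.check false, .step)
  | .check e, .sym (.cell false), none => some (.check e, .step)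
  | .check e, .sym (.cell true), some (.cell true) => some (.check e, .step)
  | .check false, .sym (.cell true), none => some (.check true, .step)
  | .check true, .sym (.cell false), some (.cell true) => some (.check false, .step)
  | .check e, .right, _ => some (.done e, .stay)
  | _, _, _ => none

/-- The reverse of `upStep`, for a fixed symbol and a fixed message. -/
def upBack : Up → TapeSym Letter → Option Letter → Option (Up × Move)
  | .scan, .left, none => some (.scan, .step)
  | .scan, .sym (.cell false), none => some (.scan, .step)
  | .scan, .sym (.cell true), some (.cell true) => some (.scan, .step)
  | .check false, .sym .centre, some .centre => some (.scan, .step)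
  | .check e, .sym (.cell false), none => some (.check e, .step)
  | .check e, .sym (.cell true), some (.cell true) => some (.check e, .step)
  | .check true, .sym (.cell true), none => some (.check false, .step)
  | .check false, .sym (.cell false), some (.cell true) => some (.check true, .step)
  | .done e, .right, _ => some (.check e, .stay)
  | _, _, _ => none

/-- The transition function of the lower component, which ignores messages. Behind the centre it
spends two steps on a cell `b` with `dw b`, and one step on every other cell. -/
def loStep (dw : Bool → Bool) : Lo → TapeSym Letter → Option (Lo × Move)
  | .scan, .right => some (.scan, .step)
  | .scan, .sym (.cell _) => some (.scan, .step)
  | .scan, .sym .centre => some (.arrive, .step)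
  | .arrive, .sym (.cell b) => if dw b then some (.linger, .stay) else some (.arrive, .step)
  | .arrive, .left => some (.linger, .stay)
  | .linger, .sym (.cell b) => if dw b then some (.arrive, .step) else none
  | _, _ => none

/-- The reverse of `loStep`, for a fixed symbol. -/
def loBack (dw : Bool → Bool) : Lo → TapeSym Letter → Option (Lo × Move)
  | .scan, .right => some (.scan, .step)
  | .scan, .sym (.cell _) => some (.scan, .step)
  | .arrive, .sym .centre => some (.scan, .step)
  | .linger, .sym (.cell b) => if dw b then some (.arrive, .stay) else none
  | .linger, .left => some (.arrive, .stay)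
  | .arrive, .sym (.cell b) => if dw b then some (.linger, .step) else some (.arrive, .step)
  | _, _ => none

/-- The broadcast function of the lower component: a symbol is announced in the step in which the
head leaves it. -/
def loMsg (dw : Bool → Bool) : Lo → TapeSym Letter → Option Letter
  | .arrive, .sym (.cell b) => if dw b then none else msgOf (.sym (.cell b))
  | _, x => msgOf x

/-- The reverse broadcast function of the lower component. -/
def loBackMsg : Lo → TapeSym Letter → Option Letter
  | .linger, _ => none
  | _, x => msgOf x

theorem upStep_iff_upBack (p p' : Up) (x : TapeSym Letter) (m : Option Letter) (d : Move) :
    upStep p x m = some (p', d) ↔ upBack p' x m = some (p, d) := by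
  rcases p with _ | (_ | _) | (_ | _) <;> rcases p' with _ | (_ | _) | (_ | _) <;>
    rcases x with _ | _ | (_ | _) | _ <;> rcases m with _ | (_ | _) | _ <;>
    simp [upStep, upBack]

theorem loStep_iff_loBack (dw : Bool → Bool) (q q' : Lo) (x : TapeSym Letter) (d : Move) :
    loStep dw q x = some (q', d) ↔ loBack dw q' x = some (q, d) := by
  cases h₀ : dw false <;> cases h₁ : dw true <;>
    rcases q <;> rcases q' <;> rcases x with _ | _ | (_ | _) | _ <;> cases d <;>
    simp [loStep, loBack, h₀, h₁]

/-- The move with which a state of the upper component is entered. -/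
def upMove : Up → Move
  | .done _ => .stay
  | _ => .step

/-- The move with which a state of the lower component is entered. -/
def loMove : Lo → Move
  | .linger => .stay
  | _ => .step

theorem upStep_move {p p' : Up} {x : TapeSym Letter} {m : Option Letter} {d : Move}
    (h : upStep p x m = some (p', d)) :
    d = upMove p' := by
  rw [upStep_iff_upBack] at h
  revert h
  rcases p' with _ | (_ | _) | (_ | _) <;>
    rcases x with _ | _ | (_ | _) | _ <;> rcases m with _ | (_ | _) | _ <;>
    simp +contextual [upBack, upMove, eq_comm]

theorem loStep_move {dw : Bool → Bool} {q q' : Lo} {x : TapeSym Letter} {d : Move}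
    (h : loStep dw q x = some (q', d)) :
    d = loMove q' := by
  revert h
  cases h₀ : dw false <;> cases h₁ : dw true <;>
    rcases q <;> rcases q' <;> rcases x with _ | _ | (_ | _) | _ <;> cases d <;>
    simp [loStep, loMove, h₀, h₁]

/-- In a step of the lower component a message is determined by the state that is entered; it is
the scanned symbol if the head moves, and it is empty otherwise. -/
theorem loMsg_of_loStep {dw : Bool → Bool} {q q' : Lo} {x : TapeSym Letter} {d : Move}
    (h : loStep dw q x = some (q', d)) :
    loBackMsg q' x = loMsg dw q x ∧
      loMsg dw q x = if d.dist = 0 then none else msgOf x := by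
  revert h
  cases h₀ : dw false <;> cases h₁ : dw true <;>
    rcases q <;> rcases q' <;> rcases x with _ | _ | (_ | _) | _ <;> cases d <;>
    simp [loStep, loBackMsg, loMsg, msgOf, Move.dist, h₀, h₁]

/-- Renaming the input symbols on a tape. -/
def TapeSym.relabel {α β : Type*} (e : α → β) : TapeSym α → TapeSym β
  | .left => .left
  | .right => .right
  | .sym a => .sym (e a)

theorem relabel_tape {α β : Type*} (e : α → β) (w : List α) (i : ℕ) :
    (tape w i).relabel e = tape (w.map e) i := by
  cases i with
  | zero => rfl
  | succ i => simp only [tape, List.getElem?_map]; cases w[i]? <;> rfl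

variable {α : Type*}

/-- The system with dwelling rule `dw`, over an alphabet that is interpreted by `e`. Only the lower
component sends messages, and only the upper one accepts. -/
abbrev machine (dw : Bool → Bool) (e : α → Letter) : DPWK α where
  M := Letter
  Q₁ := Up
  Q₂ := Lo
  finiteM := inferInstance
  finiteQ₁ := inferInstance
  finiteQ₂ := inferInstance
  μ₁ := fun _ _ => none
  μ₂ := fun q x => loMsg dw q (x.relabel e)
  δ₁ := fun p x m => upStep p (x.relabel e) m
  δ₂ := fun q x _ => loStep dw q (x.relabel e)
  start₁ := .scan
  start₂ := .scan
  F₁ := {p | ∃ b, p = .done b}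
  F₂ := ∅

/-- The reverse functions of `machine dw e`. -/
abbrev machineBack (dw : Bool → Bool) (e : α → Letter) : (machine dw e).Reverse where
  μ₁ := fun _ _ => none
  μ₂ := fun q x => loBackMsg q (x.relabel e)
  δ₁ := fun p x m => upBack p (x.relabel e) m
  δ₂ := fun q x _ => loBack dw q (x.relabel e)

theorem machine_step_iff {dw : Bool → Bool} {e : α → Letter} {w : List α}
    {C C' : (machine dw e).Config w.length} :
    (machine dw e).Step w C C' ↔ ∃ d₁ d₂ : Move,
      upStep C.state₁ (tape (w.map e) C.head₁) (loMsg dw C.state₂ (tape (w.map e) C.head₂))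
        = some (C'.state₁, d₁) ∧
      loStep dw C.state₂ (tape (w.map e) C.head₂) = some (C'.state₂, d₂) ∧
      (C'.head₁ : ℕ) = C.head₁ + d₁.dist ∧ (C'.head₂ : ℕ) + d₂.dist = C.head₂ := by
  simp only [DPWK.Step, machine, relabel_tape]

theorem machineBack_step_iff {dw : Bool → Bool} {e : α → Letter} {w : List α}
    {C C' : (machine dw e).Config w.length} :
    (machineBack dw e).Step w C' C ↔ ∃ d₁ d₂ : Move,
      upBack C'.state₁ (tape (w.map e) C.head₁) (loBackMsg C'.state₂ (tape (w.map e) C.head₂))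
        = some (C.state₁, d₁) ∧
      loBack dw C'.state₂ (tape (w.map e) C.head₂) = some (C.state₂, d₂) ∧
      (C.head₁ : ℕ) + d₁.dist = C'.head₁ ∧ (C.head₂ : ℕ) = C'.head₂ + d₂.dist := by
  simp only [DPWK.Reverse.Step, relabel_tape]

theorem machine_reversible (dw : Bool → Bool) (e : α → Letter) :
    (machine dw e).ReversibleBy (machineBack dw e) := by
  refine ⟨fun w C₁ C₂ C' h₁ h₂ => ?_, fun w C C' => ?_⟩
  · rw [machine_step_iff] at h₁ h₂
    obtain ⟨d₁, d₂, hu, hl, hi, hj⟩ := h₁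
    obtain ⟨d₁', d₂', hu', hl', hi', hj'⟩ := h₂
    -- The entered states determine the moves, hence the old positions and the symbols there.
    obtain rfl : d₁ = d₁' := (upStep_move hu).trans (upStep_move hu').symm
    obtain rfl : d₂ = d₂' := (loStep_move hl).trans (loStep_move hl').symm
    have e₁ : C₁.head₁ = C₂.head₁ := Fin.ext (by omega)
    have e₂ : C₁.head₂ = C₂.head₂ := Fin.ext (by omega)
    rw [← (loMsg_of_loStep hl).1] at hu
    rw [← (loMsg_of_loStep hl').1] at hu'
    have fu := (upStep_iff_upBack _ _ _ _ _).1 hu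
    have fu' := (upStep_iff_upBack _ _ _ _ _).1 hu'
    have fl := (loStep_iff_loBack _ _ _ _ _).1 hl
    have fl' := (loStep_iff_loBack _ _ _ _ _).1 hl'
    rw [e₁, e₂] at fu
    rw [e₂] at fl
    exact DPWK.Config.ext (congrArg Prod.fst (Option.some.inj (fu.symm.trans fu')))
      (congrArg Prod.fst (Option.some.inj (fl.symm.trans fl'))) e₁ e₂
  · rw [machine_step_iff, machineBack_step_iff]
    refine exists₂_congr fun d₁ d₂ => ?_
    constructor
    · rintro ⟨hu, hl, hi, hj⟩
      have hl' := (loStep_iff_loBack _ _ _ _ _).2 hl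
      rw [(loMsg_of_loStep hl').1] at hu
      exact ⟨(upStep_iff_upBack _ _ _ _ _).2 hu, hl', hi.symm, hj.symm⟩
    · rintro ⟨hu, hl, hi, hj⟩
      rw [← (loMsg_of_loStep hl).1] at hu
      exact ⟨(upStep_iff_upBack _ _ _ _ _).1 hu, (loStep_iff_loBack _ _ _ _ _).1 hl,
        hi.symm, hj.symm⟩

/-! ### Counting messages -/

/-- The number of cells at positions `0, …, i - 1` whose symbol is announced. -/
def announced (l : List Letter) (i : ℕ) : ℕ :=
  Nat.count (fun p => (msgOf (tape l p)).isSome = true) i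

theorem announced_succ (l : List Letter) (i : ℕ) :
    announced l (i + 1) = announced l i + (msgOf (tape l i)).toList.length := by
  rw [announced, Nat.count_succ, announced]
  cases msgOf (tape l i) <;> simp

theorem machine_sent (dw : Bool → Bool) (e : α → Letter) (w : List α)
    (C : (machine dw e).Config w.length) :
    (machine dw e).sent w C = (loMsg dw C.state₂ (tape (w.map e) C.head₂)).toList.length := by
  simp [DPWK.sent, machine, messageCount, relabel_tape]

theorem machineBack_sent (dw : Bool → Bool) (e : α → Letter) (w : List α)
    (C C' : (machine dw e).Config w.length) :
    (machineBack dw e).sent w C' C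
      = (loBackMsg C'.state₂ (tape (w.map e) C.head₂)).toList.length := by
  simp only [DPWK.Reverse.sent, messageCount, relabel_tape, Option.toList_none,
    List.length_nil, zero_add]

theorem machine_sent_step {dw : Bool → Bool} {e : α → Letter} {w : List α}
    {C C' : (machine dw e).Config w.length} (h : (machine dw e).Step w C C') :
    (machine dw e).sent w C + announced (w.map e) (C'.head₂ + 1)
        = announced (w.map e) (C.head₂ + 1) ∧
      (machineBack dw e).sent w C' C = (machine dw e).sent w C := by
  rw [machine_step_iff] at h
  obtain ⟨d₁, d₂, hu, hl, hi, hj⟩ := h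
  obtain ⟨h₁, h₂⟩ := loMsg_of_loStep hl
  rw [machine_sent, machineBack_sent, h₁]
  refine ⟨?_, rfl⟩
  cases d₂ with
  | stay =>
    obtain hj : (C'.head₂ : ℕ) = C.head₂ := hj
    simp [h₂, hj, Move.dist]
  | step =>
    obtain hj : (C'.head₂ : ℕ) + 1 = C.head₂ := hj
    rw [h₂, hj, announced_succ _ C.head₂, add_comm]
    rfl

/-- The messages of a computation are accounted for by the announced cells that the head of the
lower component leaves in it. -/
theorem exists_run {dw : Bool → Bool} {e : α → Letter} {w : List α}
    {C C' : (machine dw e).Config w.length}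
    (h : Relation.ReflTransGen ((machine dw e).Step w) C C') :
    ∃ k, (machine dw e).Run w C k C' ∧
      k + announced (w.map e) (C'.head₂ + 1) = announced (w.map e) (C.head₂ + 1) := by
  induction h using Relation.ReflTransGen.head_induction_on with
  | refl => exact ⟨0, .refl _, by simp⟩
  | head hs _ ih =>
    obtain ⟨k, hr, hk⟩ := ih
    exact ⟨_, .step hs hr, by rw [← (machine_sent_step hs).1, ← hk, add_assoc]⟩

theorem exists_reverse_run {dw : Bool → Bool} {e : α → Letter} {w : List α}
    {C C' : (machine dw e).Config w.length}
    (h : Relation.ReflTransGen ((machine dw e).Step w) C C') :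
    ∃ k, (machineBack dw e).Run w C' k C ∧
      k + announced (w.map e) (C'.head₂ + 1) = announced (w.map e) (C.head₂ + 1) := by
  induction h with
  | refl => exact ⟨0, .refl _, by simp⟩
  | tail _ hs ih =>
    obtain ⟨k, hr, hk⟩ := ih
    refine ⟨_, .step (((machine_reversible dw e).2 w _ _).2 hs) hr, ?_⟩
    rw [(machine_sent_step hs).2, ← hk, ← (machine_sent_step hs).1]
    ring

/-- The bound on the communication: every announced cell is announced at most once, and one more
message may be sent in the halting configuration. -/
theorem machine_commBoundedBy (dw : Bool → Bool) (e : α → Letter) (f : ℕ → ℕ)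
    (hf : ∀ w ∈ (machine dw e).language, announced (w.map e) (w.length + 2) + 1 ≤ f w.length) :
    (machine dw e).CommBoundedBy (machineBack dw e) f := by
  intro w hw
  have hfw := hf w hw
  obtain ⟨C, hC, hH, hA⟩ := hw
  obtain ⟨k, hr, hk⟩ := exists_run hC
  obtain ⟨k', hr', hk'⟩ := exists_reverse_run hC
  have h0 : (((machine dw e).init w.length).head₂ : ℕ) + 1 = w.length + 2 := by simp [DPWK.init]
  rw [h0] at hk hk'
  have h1 : (machine dw e).sent w C ≤ 1 := by
    rw [machine_sent, Option.length_toList]; split_ifs <;> omega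
  exact ⟨C, hH, hA, ⟨k, hr, by omega⟩, ⟨k', hr', by omega⟩⟩

/-! ### Palindromes with a centre -/

/-- The word of length `m` over the cells with marks at the positions given by `β`. -/
def half (β : ℕ → Bool) (m : ℕ) : List Letter :=
  (List.range m).map fun p => Letter.cell (β p)

/-- The palindrome whose right half is `half β m`; thus `β p` belongs to the cells at distance
`p + 1` from the centre, on both sides. -/
def pal (β : ℕ → Bool) (m : ℕ) : List Letter :=
  (half β m).reverse ++ Letter.centre :: half β m

@[simp]
theorem length_half (β : ℕ → Bool) (m : ℕ) : (half β m).length = m := by simp [half]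

@[simp]
theorem length_pal (β : ℕ → Bool) (m : ℕ) : (pal β m).length = 2 * m + 1 := by
  simp [pal]; omega

theorem half_getElem? (β : ℕ → Bool) {m p : ℕ} (h : p < m) :
    (half β m)[p]? = some (Letter.cell (β p)) := by simp [half, h]

theorem tape_pal_left (β : ℕ → Bool) {m q j : ℕ} (h : q < m) (hj : j + q = m) :
    tape (pal β m) j = .sym (.cell (β q)) := by
  obtain ⟨i, rfl⟩ : ∃ i, j = i + 1 := ⟨j - 1, by omega⟩
  have : (pal β m)[i]? = some (Letter.cell (β q)) := by
    rw [pal, List.getElem?_append_left (by simp; omega), List.getElem?_reverse (by simp; omega),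
      ← half_getElem? β h]
    congr 1
    simp; omega
  simp [tape, this]

theorem tape_pal_centre (β : ℕ → Bool) (m : ℕ) : tape (pal β m) (m + 1) = .sym .centre := by
  have : (pal β m)[m]? = some Letter.centre := by
    rw [pal, List.getElem?_append_right (by simp)]; simp
  simp [tape, this]

theorem tape_pal_right (β : ℕ → Bool) {m t : ℕ} (h : t < m) :
    tape (pal β m) (m + 2 + t) = .sym (.cell (β t)) := by
  rw [show m + 2 + t = (m + 1 + t) + 1 by omega]
  have : (pal β m)[m + 1 + t]? = some (Letter.cell (β t)) := by
    rw [pal, List.getElem?_append_right (by simp; omega), ← half_getElem? β h]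
    simp [show m + 1 + t - m = t + 1 by omega]
  simp [tape, this]

theorem tape_of_length_lt {l : List α} {i : ℕ} (h : l.length < i) : tape l i = .right := by
  obtain ⟨i, rfl⟩ : ∃ j, i = j + 1 := ⟨i - 1, by omega⟩
  simp [tape, List.getElem?_eq_none (show l.length ≤ i by omega)]

theorem length_lt_of_tape {l : List α} {i : ℕ} (h : tape l i = .right) : l.length < i := by
  cases i with
  | zero => simp [tape] at h
  | succ i =>
    by_contra hi
    simp [tape, List.getElem?_eq_getElem (show i < l.length by omega)] at h

theorem eq_zero_of_tape {l : List α} {i : ℕ} (h : tape l i = .left) : i = 0 := by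
  cases i with
  | zero => rfl
  | succ i => simp only [tape] at h; split at h <;> simp at h

theorem tape_injective : Function.Injective (tape : List α → ℕ → TapeSym α) := by
  intro l l' h
  refine List.ext_getElem? fun i => ?_
  have := congrFun h (i + 1)
  simp only [tape] at this
  cases h₁ : l[i]? <;> cases h₂ : l'[i]? <;> simp_all

theorem eq_pal {l : List Letter} {β : ℕ → Bool} {m : ℕ} (hm : l.length = 2 * m + 1)
    (hc : tape l (m + 1) = .sym .centre)
    (hr : ∀ t < m, tape l (m + 2 + t) = .sym (.cell (β t)))
    (hl : ∀ t < m, tape l (m - t) = .sym (.cell (β t))) : l = pal β m := by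
  refine tape_injective (funext fun p => ?_)
  obtain rfl | h | rfl | h | h :
      p = 0 ∨ (1 ≤ p ∧ p ≤ m) ∨ p = m + 1 ∨ (m + 2 ≤ p ∧ p < m + 2 + m) ∨ 2 * m + 1 < p := by omega
  · rfl
  · have := hl (m - p) (by omega)
    rw [show m - (m - p) = p by omega] at this
    rw [this, tape_pal_left β (by omega) (show p + (m - p) = m by omega)]
  · rw [hc, tape_pal_centre]
  · obtain ⟨t, rfl⟩ := Nat.exists_eq_add_of_le h.1
    rw [hr t (by omega), tape_pal_right β (by omega)]
  · rw [tape_of_length_lt (by omega), tape_of_length_lt (by simpa)]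

/-- The number of marks among the first `t` cells behind the centre. -/
def marks (β : ℕ → Bool) (t : ℕ) : ℕ := Nat.count (fun p => β p = true) t

theorem marks_succ (β : ℕ → Bool) (t : ℕ) : marks β (t + 1) = marks β t + (β t).toNat := by
  rw [marks, Nat.count_succ, marks]; cases β t <;> simp

theorem marks_mono (β : ℕ → Bool) : Monotone (marks β) := Nat.count_monotone _

/-- A mark in the right half is announced by the lower component before the centre, and its mirror
image behind the centre. -/
theorem announced_pal (β : ℕ → Bool) (m : ℕ) :
    announced (pal β m) (2 * m + 3) = 2 * marks β m + 1 := by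
  have hcell : ∀ b : Bool, (msgOf (.sym (.cell b))).toList.length = b.toNat := by
    rintro (_ | _) <;> rfl
  have hleft : ∀ q ≤ m, announced (pal β m) (m - q + 1) + marks β q
      = announced (pal β m) (m + 1) := by
    intro q
    induction q with
    | zero => intro _; simp [marks]
    | succ q ih =>
      intro hq
      rw [← ih (by omega), show m - q + 1 = (m - (q + 1) + 1) + 1 by omega,
        announced_succ _ (m - (q + 1) + 1), marks_succ,
        tape_pal_left β (show q < m by omega) (by omega), hcell]
      ring
  have hright : ∀ t ≤ m, announced (pal β m) (m + 2 + t)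
      = announced (pal β m) (m + 2) + marks β t := by
    intro t
    induction t with
    | zero => intro _; simp [marks]
    | succ t ih =>
      intro ht
      rw [← add_assoc, announced_succ, ih (by omega), marks_succ, tape_pal_right β (by omega),
        hcell, add_assoc]
  have h0 : announced (pal β m) 1 = 0 := by rw [announced_succ]; rfl
  have h1 := hleft m le_rfl
  have h2 := hright m le_rfl
  rw [announced_succ _ (m + 1), tape_pal_centre, ← h1, Nat.sub_self, zero_add, h0] at h2
  rw [show 2 * m + 3 = (m + 2 + m) + 1 by omega, announced_succ, h2,
    tape_of_length_lt (by simp; omega)]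
  simp [msgOf]
  omega

/-- The time at which the lower component, on its way from the centre to the left, arrives at the
`q`-th cell. -/
def arrival (dw : Bool → Bool) (β : ℕ → Bool) (q : ℕ) : ℕ :=
  q + Nat.count (fun p => dw (β p) = true) q

theorem arrival_succ (dw : Bool → Bool) (β : ℕ → Bool) (q : ℕ) :
    arrival dw β (q + 1) = arrival dw β q + 1 + (dw (β q)).toNat := by
  rw [arrival, Nat.count_succ, arrival]
  cases dw (β q) <;> simp <;> omega

theorem arrival_strictMono (dw : Bool → Bool) (β : ℕ → Bool) : StrictMono (arrival dw β) :=
  strictMono_nat_of_lt_succ fun q => by rw [arrival_succ]; omega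

theorem le_arrival (dw : Bool → Bool) (β : ℕ → Bool) (q : ℕ) : q ≤ arrival dw β q :=
  Nat.le_add_right _ _

theorem exists_arrival (dw : Bool → Bool) (β : ℕ → Bool) (t : ℕ) :
    ∃ q, arrival dw β q ≤ t ∧ t < arrival dw β (q + 1) := by
  induction t with
  | zero =>
    exact ⟨0, by simp [arrival], lt_of_lt_of_le (by simp) (le_arrival dw β (0 + 1))⟩
  | succ t ih =>
    obtain ⟨q, h₁, h₂⟩ := ih
    by_cases h : t + 1 < arrival dw β (q + 1)
    · exact ⟨q, by omega, h⟩
    · exact ⟨q + 1, by omega, by have := arrival_strictMono dw β (Nat.lt_add_one (q + 1)); omega⟩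

/-- When the upper component is `t` cells and the lower one `q` cells behind the centre, the upper
one has read at most one mark more than the lower one. -/
def Sparse (dw : Bool → Bool) (β : ℕ → Bool) (m : ℕ) : Prop :=
  ∀ t ≤ m, ∀ q, arrival dw β q ≤ t → t < arrival dw β (q + 1) → marks β t ≤ marks β q + 1

/-! ### The language of the machine -/

section Machine

variable {dw : Bool → Bool} {e : α → Letter} {w : List α} {β : ℕ → Bool} {m : ℕ}

theorem machine_exists_step {C : (machine dw e).Config w.length} {p' : Up} {q' : Lo} {d₁ d₂ : Move}
    (hu : upStep C.state₁ (tape (w.map e) C.head₁) (loMsg dw C.state₂ (tape (w.map e) C.head₂))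
        = some (p', d₁))
    (hl : loStep dw C.state₂ (tape (w.map e) C.head₂) = some (q', d₂))
    (hi : C.head₁ + d₁.dist ≤ w.length + 1) (hj : d₂.dist ≤ C.head₂) :
    ∃ C', (machine dw e).Step w C C' := by
  refine ⟨⟨p', q', ⟨C.head₁ + d₁.dist, by omega⟩, ⟨C.head₂ - d₂.dist, by omega⟩⟩, ?_⟩
  rw [machine_step_iff]
  exact ⟨d₁, d₂, hu, hl, rfl, by simp; omega⟩

/-- Both components scan towards the centre, and have made `t` steps. -/
def ScanPhase (dw : Bool → Bool) (e : α → Letter) (w : List α) (t : ℕ)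
    (C : (machine dw e).Config w.length) : Prop :=
  C.state₁ = .scan ∧ C.state₂ = .scan ∧ (C.head₁ : ℕ) = t ∧ t + C.head₂ = w.length + 1

/-- The lower component, at time `t` behind the centre, is in state `s` on the `q`-th cell. -/
def LoAt (dw : Bool → Bool) (β : ℕ → Bool) (t q : ℕ) (s : Lo) : Prop :=
  (s = .arrive ∧ t = arrival dw β q) ∨ (s = .linger ∧ t = arrival dw β q + 1 ∧ dw (β q) = true)

theorem LoAt.bounds {t q : ℕ} {s : Lo} (h : LoAt dw β t q s) :
    arrival dw β q ≤ t ∧ t < arrival dw β (q + 1) := by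
  rw [arrival_succ]
  rcases h with ⟨_, h⟩ | ⟨_, h, h'⟩
  · omega
  · rw [h']; simp; omega

theorem LoAt.unique {t q q' : ℕ} {s : Lo} (h : LoAt dw β t q s) (h₁ : arrival dw β q' ≤ t)
    (h₂ : t < arrival dw β (q' + 1)) : q' = q := by
  obtain ⟨h₃, h₄⟩ := h.bounds
  have := (arrival_strictMono dw β).lt_iff_lt.1 (h₁.trans_lt h₄)
  have := (arrival_strictMono dw β).lt_iff_lt.1 (h₃.trans_lt h₂)
  omega

/-- The move of the lower component behind the centre; `y` tells whether a mark is announced. -/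
theorem LoAt.next {t q : ℕ} {s : Lo} (h : LoAt dw β t q s) :
    ∃ (s' : Lo) (d : Move) (y : Bool), loStep dw s (.sym (.cell (β q))) = some (s', d) ∧
      loMsg dw s (.sym (.cell (β q))) = (if y then some (.cell true) else none) ∧
      marks β (q + d.dist) = marks β q + y.toNat ∧ LoAt dw β (t + 1) (q + d.dist) s' := by
  have hmsg : ∀ b : Bool, msgOf (.sym (.cell b)) = if b then some (.cell true) else none := by
    rintro (_ | _) <;> rfl
  rcases h with ⟨rfl, rfl⟩ | ⟨rfl, rfl, hd⟩
  · cases hd : dw (β q) with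
    | false =>
      refine ⟨.arrive, .step, β q, by simp [loStep, hd], by simp [loMsg, hd, hmsg],
        marks_succ β q, Or.inl ⟨rfl, ?_⟩⟩
      rw [Move.dist, arrival_succ, hd]; rfl
    | true =>
      exact ⟨.linger, .stay, false, by simp [loStep, hd], by simp [loMsg, hd], by simp [Move.dist],
        Or.inr ⟨rfl, rfl, hd⟩⟩
  · refine ⟨.arrive, .step, β q, by simp [loStep, hd], by simp [loMsg, hmsg],
      marks_succ β q, Or.inl ⟨rfl, ?_⟩⟩
    rw [Move.dist, arrival_succ, hd]; rfl

theorem upStep_check_iff {d x y : Bool} {p : Up} {v : Move} :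
    upStep (.check d) (.sym (.cell x)) (if y then some (.cell true) else none) = some (p, v) ↔
      v = .step ∧ ∃ d', p = .check d' ∧ d.toNat + x.toNat = d'.toNat + y.toNat := by
  cases d <;> cases x <;> cases y <;> simp [upStep, eq_comm, and_comm]

/-- The upper component is `t` cells behind the centre of a palindrome, and the lower one is on its
way back to the left. -/
def CheckPhase (dw : Bool → Bool) (e : α → Letter) (w : List α) (β : ℕ → Bool) (m t : ℕ)
    (C : (machine dw e).Config w.length) : Prop :=
  ∃ q d, C.state₁ = .check d ∧ (C.head₁ : ℕ) = m + 2 + t ∧ C.head₂ + q = m ∧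
    marks β t = marks β q + d.toNat ∧ LoAt dw β t q C.state₂

theorem CheckPhase.marks_le {t q : ℕ} {C : (machine dw e).Config w.length}
    (hC : CheckPhase dw e w β m t C) (h₁ : arrival dw β q ≤ t) (h₂ : t < arrival dw β (q + 1)) :
    marks β t ≤ marks β q + 1 := by
  obtain ⟨q', d, -, -, -, hm, hl⟩ := hC
  rw [hl.unique h₁ h₂, hm]
  have := Bool.toNat_le d
  omega

theorem CheckPhase.step {t : ℕ} (hw : w.map e = pal β m) (ht : t < m)
    {C C' : (machine dw e).Config w.length}
    (hC : CheckPhase dw e w β m t C) (hs : (machine dw e).Step w C C') :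
    CheckPhase dw e w β m (t + 1) C' := by
  obtain ⟨q, d, h₁, hi, hj, hm, hl⟩ := hC
  have hq : q < m := by have := le_arrival dw β q; have := hl.bounds.1; omega
  obtain ⟨s', v, y, hs', hmsg, hmk, hl'⟩ := hl.next
  obtain ⟨d₁, d₂, hu, hlo, hi', hj'⟩ := machine_step_iff.1 hs
  rw [h₁, hi, hw, tape_pal_right β ht, tape_pal_left β hq hj, hmsg, upStep_check_iff] at hu
  rw [hw, tape_pal_left β hq hj, hs'] at hlo
  obtain ⟨rfl, d', hd', hdd⟩ := hu
  obtain ⟨rfl, rfl⟩ : s' = C'.state₂ ∧ v = d₂ := by simpa using hlo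
  refine ⟨q + v.dist, d', hd', by simp only [Move.dist] at hi'; omega, by omega, ?_, hl'⟩
  rw [marks_succ, hmk]
  omega

theorem CheckPhase.exists_step {t : ℕ} (hw : w.map e = pal β m) (hsp : Sparse dw β m) (ht : t < m)
    {C : (machine dw e).Config w.length} (hC : CheckPhase dw e w β m t C) :
    ∃ C', (machine dw e).Step w C C' := by
  obtain ⟨q, d, h₁, hi, hj, hm, hl⟩ := hC
  have hlen : w.length = 2 * m + 1 := by rw [← length_pal β m, ← hw, List.length_map]
  have hq : q < m := by have := le_arrival dw β q; have := hl.bounds.1; omega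
  obtain ⟨s', v, y, hs', hmsg, hmk, hl'⟩ := hl.next
  have hle : marks β (t + 1) ≤ marks β (q + v.dist) + 1 :=
    hsp (t + 1) ht _ hl'.bounds.1 hl'.bounds.2
  have hge : marks β (q + v.dist) ≤ marks β (t + 1) :=
    marks_mono β ((le_arrival dw β _).trans hl'.bounds.1)
  have hv : v.dist ≤ 1 := by cases v <;> simp [Move.dist]
  rw [marks_succ] at hle hge
  obtain ⟨d', hd'⟩ : ∃ d' : Bool, d.toNat + (β t).toNat = d'.toNat + y.toNat := by
    have : d.toNat + (β t).toNat = y.toNat ∨ d.toNat + (β t).toNat = 1 + y.toNat := by omega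
    rcases this with h | h
    · exact ⟨false, by simpa using h⟩
    · exact ⟨true, by simpa using h⟩
  refine machine_exists_step (p' := .check d') (q' := s') (d₁ := .step) (d₂ := v) ?_ ?_ ?_ ?_
  · rw [h₁, hi, hw, tape_pal_right β ht, tape_pal_left β hq hj, hmsg, upStep_check_iff]
    exact ⟨rfl, d', rfl, hd'⟩
  · rw [hw, tape_pal_left β hq hj, hs']
  · rw [hi, hlen]; simp [Move.dist]; omega
  · omega

/-- At the right end the upper component can enter an accepting state, since the lower component can
move as well. -/
theorem CheckPhase.last {C : (machine dw e).Config w.length} (hw : w.map e = pal β m)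
    (hC : CheckPhase dw e w β m m C) :
    ∃ C', (machine dw e).Step w C C' := by
  obtain ⟨q, d, h₁, hi, hj, hm, hl⟩ := hC
  have hlen : w.length = 2 * m + 1 := by rw [← length_pal β m, ← hw, List.length_map]
  have hright : tape (pal β m) (m + 2 + m) = .right := tape_of_length_lt (by simp; omega)
  have hu : ∀ x, upStep (.check d) .right x = some (.done d, .stay) := by
    intro x; cases d <;> rfl
  by_cases hq : q < m
  · obtain ⟨s', v, y, hs', -, -, -⟩ := hl.next
    have hv : v.dist ≤ 1 := by cases v <;> simp [Move.dist]
    refine machine_exists_step (p' := .done d) (q' := s') (d₁ := .stay) (d₂ := v) ?_ ?_ ?_ ?_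
    · rw [h₁, hi, hw, hright, hu]
    · rw [hw, tape_pal_left β hq hj, hs']
    · simp only [Move.dist]; omega
    · omega
  -- The lower component has reached the left end just now.
  · have h₂ : C.state₂ = .arrive := by
      rcases hl with h | h
      · exact h.1
      · have := le_arrival dw β q; omega
    have hj0 : (C.head₂ : ℕ) = 0 := by omega
    refine machine_exists_step (p' := .done d) (q' := .linger) (d₁ := .stay) (d₂ := .stay)
      ?_ ?_ ?_ ?_
    · rw [h₁, hi, hw, hright, hu]
    · rw [h₂, hj0]; rfl
    · simp only [Move.dist]; omega
    · simp [Move.dist]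

theorem halting_of_done {d : Bool} {C : (machine dw e).Config w.length} (hC : C.state₁ = .done d) :
    (machine dw e).Halting w C := by
  intro C' hs
  obtain ⟨d₁, d₂, hu, -⟩ := machine_step_iff.1 hs
  rw [hC] at hu
  simp [upStep] at hu

/-- The accepting computation takes `m + 1` steps to the centre, `m` further steps until the upper
component is at the right end, and one step into the accepting state. -/
theorem mem_language_of_sparse (hw : w.map e = pal β m) (hsp : Sparse dw β m) :
    w ∈ (machine dw e).language := by
  have hlen : w.length = 2 * m + 1 := by rw [← length_pal β m, ← hw, List.length_map]
  have hmsg : ∀ b : Bool, upStep .scan (.sym (.cell b)) (loMsg dw .scan (.sym (.cell b)))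
      = some (.scan, .step) := by rintro (_ | _) <;> rfl
  have hlo : ∀ b : Bool, loStep dw .scan (.sym (.cell b)) = some (.scan, .step) := fun _ => rfl
  have hscan : ∀ t ≤ m + 1, ∃ C, Relation.ReflTransGen ((machine dw e).Step w)
      ((machine dw e).init w.length) C ∧ ScanPhase dw e w t C := by
    intro t
    induction t with
    | zero => exact fun _ => ⟨_, .refl, rfl, rfl, rfl, by simp [DPWK.init]⟩
    | succ t ih =>
      intro ht
      obtain ⟨C, hC, h₁, h₂, hi, hj⟩ := ih (by omega)
      have key : upStep .scan (tape (w.map e) t) (loMsg dw .scan (tape (w.map e) C.head₂))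
            = some (.scan, .step) ∧
          loStep dw .scan (tape (w.map e) C.head₂) = some (.scan, .step) := by
        rcases Nat.eq_zero_or_pos t with rfl | h0
        · rw [tape_of_length_lt (i := C.head₂) (by simp; omega)]
          exact ⟨rfl, rfl⟩
        · obtain ⟨s, hs⟩ : ∃ s, t + s = m := ⟨m - t, by omega⟩
          rw [hw, tape_pal_left β (by omega) hs,
            show (C.head₂ : ℕ) = m + 2 + s by omega, tape_pal_right β (by omega)]
          exact ⟨hmsg _, hlo _⟩
      refine ⟨⟨.scan, .scan, ⟨t + 1, by omega⟩, ⟨C.head₂ - 1, by omega⟩⟩, hC.tail ?_,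
        rfl, rfl, rfl, by simp; omega⟩
      rw [machine_step_iff]
      refine ⟨.step, .step, ?_, ?_, by simp [Move.dist, hi], by simp [Move.dist]; omega⟩
      · rw [h₁, h₂, hi]; exact key.1
      · rw [h₂]; exact key.2
  have hcheck : ∀ t ≤ m, ∃ C, Relation.ReflTransGen ((machine dw e).Step w)
      ((machine dw e).init w.length) C ∧ CheckPhase dw e w β m t C := by
    intro t
    induction t with
    | zero =>
      intro _
      obtain ⟨C, hC, h₁, h₂, hi, hj⟩ := hscan (m + 1) le_rfl
      have hj' : (C.head₂ : ℕ) = m + 1 := by omega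
      refine ⟨⟨.check false, .arrive, ⟨m + 2, by omega⟩, ⟨m, by omega⟩⟩, hC.tail ?_,
        0, false, rfl, rfl, rfl, by simp, Or.inl ⟨rfl, by simp [arrival]⟩⟩
      rw [machine_step_iff]
      refine ⟨.step, .step, ?_, ?_, by simp [Move.dist, hi], by simp [Move.dist, hj']⟩
      · rw [h₁, h₂, hi, hj', hw, tape_pal_centre]; rfl
      · rw [h₂, hj', hw, tape_pal_centre]; rfl
    | succ t ih =>
      intro ht
      obtain ⟨C, hC, hC'⟩ := ih (by omega)
      obtain ⟨C', hs⟩ := hC'.exists_step hw hsp (by omega)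
      exact ⟨C', hC.tail hs, hC'.step hw (by omega) hs⟩
  obtain ⟨C, hC, hC'⟩ := hcheck m le_rfl
  obtain ⟨C', hs⟩ := hC'.last hw
  obtain ⟨q, d, h₁, hi, -⟩ := hC'
  obtain ⟨d₁, d₂, hu, -⟩ := machine_step_iff.1 hs
  rw [h₁, hi, hw, tape_of_length_lt (by simp; omega)] at hu
  have hd : C'.state₁ = .done d := by
    have : upStep (.check d) .right (loMsg dw C.state₂ (tape (pal β m) C.head₂))
        = some (.done d, .stay) := by cases d <;> rfl
    rw [this] at hu
    exact (congrArg Prod.fst (Option.some.inj hu)).symm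
  exact ⟨C', hC.tail hs, halting_of_done hd, Or.inl ⟨d, hd⟩⟩

/-- An invariant of the computation: the components scan two halves that agree so far; or they have
read two different centres simultaneously, so that the upper component will be stuck at the second
one; or they are behind the centre of a palindrome that is sparse so far; or the upper component has
reached the right end of a sparse palindrome. -/
def Invariant (dw : Bool → Bool) (e : α → Letter) (w : List α)
    (C : (machine dw e).Config w.length) : Prop :=
  (∃ t, ScanPhase dw e w t C ∧ ∀ p, 1 ≤ p → p < t → ∃ b,
    tape (w.map e) p = .sym (.cell b) ∧ tape (w.map e) (w.length + 1 - p) = .sym (.cell b)) ∨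
  (∃ d r, C.state₁ = .check d ∧ C.head₁ ≤ r ∧ tape (w.map e) r = .sym .centre) ∨
  (∃ β m t, w.map e = pal β m ∧ t ≤ m ∧ CheckPhase dw e w β m t C ∧ Sparse dw β t) ∨
  (∃ d, C.state₁ = .done d ∧ ∃ β m, w.map e = pal β m ∧ Sparse dw β m)

theorem invariant_step {C C' : (machine dw e).Config w.length} (hC : Invariant dw e w C)
    (hs : (machine dw e).Step w C C') : Invariant dw e w C' := by
  have hs₀ := hs
  rw [machine_step_iff] at hs
  obtain ⟨d₁, d₂, hu, hl, hi, hj⟩ := hs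
  have hlen : (w.map e).length = w.length := List.length_map _
  rcases hC with ⟨t, ⟨h₁, h₂, ht, htj⟩, hp⟩ | ⟨d, r, h₁, hr, hc⟩ | ⟨β, m, t, hw, ht, hC, hsp⟩ |
    ⟨d, h₁, -⟩
  · rw [h₁, h₂, ht] at hu
    rw [h₂] at hl
    have hjt : (C.head₂ : ℕ) = w.length + 1 - t := by omega
    rcases hx : tape (w.map e) t with _ | _ | b | _
    · obtain rfl := eq_zero_of_tape hx
      rw [tape_of_length_lt (i := C.head₂) (by omega)] at hl hu
      obtain ⟨h₁', rfl⟩ : Up.scan = C'.state₁ ∧ Move.step = d₁ := by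
        simpa [upStep, loMsg, msgOf, hx] using hu
      obtain ⟨h₂', rfl⟩ : Lo.scan = C'.state₂ ∧ Move.step = d₂ := by simpa [loStep] using hl
      refine Or.inl ⟨1, ⟨h₁'.symm, h₂'.symm, ?_, ?_⟩, fun p _ _ => by omega⟩
      · simp only [Move.dist] at hi; omega
      · simp only [Move.dist] at hj; omega
    · simp [upStep, hx] at hu
    · have hy : tape (w.map e) C.head₂ = .sym (.cell b) ∧ Up.scan = C'.state₁ ∧ Move.step = d₁ := by
        have h0 : tape (w.map e) C.head₂ ≠ .right := by
          intro h
          have := length_lt_of_tape h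
          have : t = 0 := by omega
          subst this
          simp [tape] at hx
        rw [hx] at hu
        rcases hy : tape (w.map e) C.head₂ with _ | _ | (_ | _) | _ <;> cases b <;>
          simp_all [upStep, loStep, loMsg, msgOf]
      obtain ⟨hy, h₁', rfl⟩ := hy
      obtain ⟨h₂', rfl⟩ : Lo.scan = C'.state₂ ∧ Move.step = d₂ := by simpa [loStep, hy] using hl
      refine Or.inl ⟨t + 1, ⟨h₁'.symm, h₂'.symm, ?_, ?_⟩, fun p hp1 hpt => ?_⟩
      · simp only [Move.dist] at hi; omega
      · simp only [Move.dist] at hj; omega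
      · rcases Nat.lt_succ_iff_lt_or_eq.1 hpt with h | rfl
        · exact hp p hp1 h
        · exact ⟨b, hx, hjt ▸ hy⟩
    · have hy : tape (w.map e) C.head₂ = .sym .centre ∧ Up.check false = C'.state₁ ∧
          Move.step = d₁ := by
        rw [hx] at hu
        rcases hy : tape (w.map e) C.head₂ with _ | _ | (_ | _) | _ <;>
          simp_all [upStep, loMsg, msgOf]
      obtain ⟨hy, h₁', rfl⟩ := hy
      obtain ⟨h₂', rfl⟩ : Lo.arrive = C'.state₂ ∧ Move.step = d₂ := by simpa [loStep, hy] using hl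
      have ht0 : 1 ≤ t := by
        rcases Nat.eq_zero_or_pos t with rfl | h
        · simp [tape] at hx
        · exact h
      have htn : t ≤ w.length := by
        by_contra h
        rw [tape_of_length_lt (by omega)] at hx
        simp at hx
      simp only [Move.dist] at hi hj
      rcases lt_trichotomy t (w.length + 1 - t) with h | h | h
      · exact Or.inr (Or.inl ⟨false, C.head₂, h₁'.symm, by omega, hy⟩)
      · obtain ⟨m, rfl⟩ : ∃ m, t = m + 1 := ⟨t - 1, by omega⟩
        have : ∀ s, ∃ b, s < m → tape (w.map e) (m + 2 + s) = .sym (.cell b) ∧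
            tape (w.map e) (m - s) = .sym (.cell b) := by
          intro s
          by_cases hs : s < m
          · obtain ⟨b, hb, hb'⟩ := hp (m - s) (by omega) (by omega)
            rw [show w.length + 1 - (m - s) = m + 2 + s by omega] at hb'
            exact ⟨b, fun _ => ⟨hb', hb⟩⟩
          · exact ⟨false, fun h => absurd h hs⟩
        choose β hβ using this
        refine Or.inr (Or.inr (Or.inl ⟨β, m, 0,
          eq_pal (by omega) hx (fun s hs => (hβ s hs).1) fun s hs => (hβ s hs).2, Nat.zero_le _,
          ⟨0, false, h₁'.symm, by omega, by omega, by simp, Or.inl ⟨h₂'.symm, by simp [arrival]⟩⟩,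
          fun t ht q _ _ => ?_⟩))
        obtain rfl : t = 0 := by omega
        simp [marks]
      · obtain ⟨b, -, hb⟩ := hp (w.length + 1 - t) (by omega) h
        rw [show w.length + 1 - (w.length + 1 - t) = t by omega, hx] at hb
        simp at hb
  · refine Or.inr (Or.inl ?_)
    rw [h₁] at hu
    have hrn : r ≤ w.length := by
      by_contra h
      rw [tape_of_length_lt (by omega)] at hc
      simp at hc
    have hxr : tape (w.map e) C.head₁ ≠ .right := fun h => by
      have := length_lt_of_tape h
      omega
    have hne : (C.head₁ : ℕ) ≠ r := by
      intro h
      rw [h, hc] at hu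
      cases d <;> simp [upStep] at hu
    obtain ⟨d', hd'⟩ : ∃ d', C'.state₁ = .check d' := by
      rcases hx : tape (w.map e) C.head₁ with _ | _ | (_ | _) | _ <;>
        rcases hy : loMsg dw C.state₂ (tape (w.map e) C.head₂) with _ | (_ | _) | _ <;>
        cases d <;> simp_all [upStep]
    have hd₁ : d₁.dist ≤ 1 := by cases d₁ <;> simp [Move.dist]
    exact ⟨d', r, hd', by omega, hc⟩
  · rcases ht.lt_or_eq with ht | rfl
    · have hC' := hC.step hw ht hs₀
      refine Or.inr (Or.inr (Or.inl ⟨β, m, t + 1, hw, ht, hC', fun s hs q h h' => ?_⟩))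
      rcases Nat.le_succ_iff.1 hs with hs | rfl
      · exact hsp s hs q h h'
      · exact hC'.marks_le h h'
    · obtain ⟨q, d, h₁, hi', -⟩ := hC
      rw [h₁, hi', hw, tape_of_length_lt (by simp; omega)] at hu
      refine Or.inr (Or.inr (Or.inr ⟨d, ?_, β, t, hw, hsp⟩))
      cases d <;> simp [upStep] at hu <;> exact hu.1.symm
  · exact absurd hs₀ (halting_of_done h₁ C')

theorem mem_machine_language_iff :
    w ∈ (machine dw e).language ↔ ∃ β m, w.map e = pal β m ∧ Sparse dw β m := by
  refine ⟨fun ⟨C, hC, hH, hA⟩ => ?_, fun ⟨β, m, hw, hsp⟩ => mem_language_of_sparse hw hsp⟩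
  have hinv : Invariant dw e w C := by
    clear hH hA
    induction hC with
    | refl => exact Or.inl ⟨0, ⟨rfl, rfl, rfl, by simp [DPWK.init]⟩, fun p _ _ => by omega⟩
    | tail _ hs ih => exact invariant_step ih hs
  obtain ⟨d, hd⟩ : ∃ d, C.state₁ = .done d := by
    rcases hA with h | h
    · exact h
    · exact h.elim
  rcases hinv with ⟨t, ⟨h₁, -⟩, -⟩ | ⟨d, r, h₁, -⟩ | ⟨β, m, t, -, -, ⟨q, d, h₁, -⟩, -⟩ | ⟨d, -, h⟩
  · rw [hd] at h₁; cases h₁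
  · rw [hd] at h₁; cases h₁
  · rw [hd] at h₁; cases h₁
  · exact h

/-- The bound on the number of marks gives the bound on the communication. -/
theorem machine_commBoundedBy_marks (dw : Bool → Bool) (e : α → Letter) (f : ℕ → ℕ)
    (hf : ∀ β m, Sparse dw β m → 2 * marks β m + 2 ≤ f (2 * m + 1)) :
    (machine dw e).CommBoundedBy (machineBack dw e) f := by
  refine machine_commBoundedBy dw e f fun w hw => ?_
  obtain ⟨β, m, hw, hsp⟩ := mem_machine_language_iff.1 hw
  have hlen : w.length = 2 * m + 1 := by rw [← length_pal β m, ← hw, List.length_map]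
  rw [hlen, hw, announced_pal]
  exact hf β m hsp

end Machine

/-! ### Computations as sequences -/

section LowerBound

namespace DPWK

variable (A : DPWK α) (w : List α)

/-- The message of the upper component in state `x.1` at position `x.2`. -/
def msg₁ (x : A.Q₁ × ℕ) : Option A.M := A.μ₁ x.1 (tape w x.2)

/-- The message of the lower component in state `x.1` at position `x.2`. -/
def msg₂ (x : A.Q₂ × ℕ) : Option A.M := A.μ₂ x.1 (tape w x.2)

/-- The upper component moves from `x` to `y` when it receives `m`. -/
def Adv₁ (m : Option A.M) (x y : A.Q₁ × ℕ) : Prop :=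
  ∃ d : Move, A.δ₁ x.1 (tape w x.2) m = some (y.1, d) ∧ y.2 = x.2 + d.dist

/-- The lower component moves from `x` to `y` when it receives `m`. -/
def Adv₂ (m : Option A.M) (x y : A.Q₂ × ℕ) : Prop :=
  ∃ d : Move, A.δ₂ x.1 (tape w x.2) m = some (y.1, d) ∧ y.2 + d.dist = x.2

/-- The upper component cannot move in `x` when it receives `m`, on inputs of length `n`. -/
def Blocked₁ (n : ℕ) (m : Option A.M) (x : A.Q₁ × ℕ) : Prop :=
  ∀ y, A.Adv₁ w m x y → n + 1 < y.2

/-- The lower component cannot move in `x` when it receives `m`. -/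
def Blocked₂ (m : Option A.M) (x : A.Q₂ × ℕ) : Prop :=
  ∀ y, ¬ A.Adv₂ w m x y

/-- An accepting computation of `T` steps, as a pair of sequences of states and positions. -/
structure Trace (T : ℕ) (a : ℕ → A.Q₁ × ℕ) (b : ℕ → A.Q₂ × ℕ) : Prop where
  start₁ : a 0 = (A.start₁, 0)
  start₂ : b 0 = (A.start₂, w.length + 1)
  step₁ : ∀ t < T, A.Adv₁ w (A.msg₂ w (b t)) (a t) (a (t + 1))
  step₂ : ∀ t < T, A.Adv₂ w (A.msg₁ w (a t)) (b t) (b (t + 1))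
  bound₁ : ∀ t ≤ T, (a t).2 < w.length + 2
  bound₂ : ∀ t ≤ T, (b t).2 < w.length + 2
  halt : A.Blocked₁ w w.length (A.msg₂ w (b T)) (a T) ∨ A.Blocked₂ w (A.msg₁ w (a T)) (b T)
  accept : (a T).1 ∈ A.F₁ ∨ (b T).1 ∈ A.F₂

variable {A w}

theorem Step.deterministic {C C₁ C₂ : A.Config w.length} (h₁ : A.Step w C C₁)
    (h₂ : A.Step w C C₂) : C₁ = C₂ := by
  obtain ⟨d, d', e₁, e₂, e₃, e₄⟩ := h₁
  obtain ⟨f, f', g₁, g₂, g₃, g₄⟩ := h₂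
  rw [e₁, Option.some_inj, Prod.mk.injEq] at g₁
  rw [e₂, Option.some_inj, Prod.mk.injEq] at g₂
  obtain ⟨g₁, rfl⟩ := g₁
  obtain ⟨g₂, rfl⟩ := g₂
  exact Config.ext g₁ g₂ (Fin.ext (by omega)) (Fin.ext (by omega))

theorem Trace.mem_language {T : ℕ} {a : ℕ → A.Q₁ × ℕ} {b : ℕ → A.Q₂ × ℕ} (h : A.Trace w T a b) :
    w ∈ A.language := by
  have reach : ∀ t, ∀ ht : t ≤ T, Relation.ReflTransGen (A.Step w) (A.init w.length)
      ⟨(a t).1, (b t).1, ⟨(a t).2, h.bound₁ t ht⟩, ⟨(b t).2, h.bound₂ t ht⟩⟩ := by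
    intro t
    induction t with
    | zero =>
      intro ht
      convert Relation.ReflTransGen.refl using 1
      exact Config.ext (by simp [h.start₁, init]) (by simp [h.start₂, init])
        (Fin.ext (by simp [h.start₁, init])) (Fin.ext (by simp [h.start₂, init]))
    | succ t ih =>
      intro ht
      refine (ih (by omega)).tail ?_
      obtain ⟨d₁, e₁, f₁⟩ := h.step₁ t ht
      obtain ⟨d₂, e₂, f₂⟩ := h.step₂ t ht
      exact ⟨d₁, d₂, e₁, e₂, f₁, f₂⟩
  refine ⟨_, reach T le_rfl, ?_, h.accept⟩
  rintro C' ⟨d₁, d₂, e₁, e₂, f₁, f₂⟩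
  rcases h.halt with hb | hb
  · have := hb (C'.state₁, C'.head₁) ⟨d₁, e₁, f₁⟩
    have := C'.head₁.isLt
    simp only at *
    omega
  · exact hb (C'.state₂, C'.head₂) ⟨d₂, e₂, f₂⟩

theorem Run.exists_seq {C C' : A.Config w.length} {k : ℕ} (h : A.Run w C k C') :
    ∃ (T : ℕ) (s : ℕ → A.Config w.length), s 0 = C ∧ s T = C' ∧
      (∀ t < T, A.Step w (s t) (s (t + 1))) ∧ k = ∑ t ∈ Finset.range T, A.sent w (s t) := by
  induction h with
  | refl C => exact ⟨0, fun _ => C, rfl, rfl, by simp, by simp⟩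
  | @step C C₁ C₂ k hs _ ih =>
    obtain ⟨T, s, h0, hT, hst, hk⟩ := ih
    refine ⟨T + 1, fun t => Nat.casesOn t C s, rfl, hT, fun t ht => ?_, ?_⟩
    · cases t with
      | zero => simpa [h0] using hs
      | succ t => exact hst t (by omega)
    · rw [Finset.sum_range_succ', hk, add_comm]
      rfl

/-- A computation that halts does not repeat a configuration. -/
theorem seq_injOn {T : ℕ} {s : ℕ → A.Config w.length}
    (hs : ∀ t < T, A.Step w (s t) (s (t + 1))) (hT : A.Halting w (s T)) :
    Function.Injective fun t : Fin (T + 1) => s t := by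
  have key : ∀ u v, u < v → v ≤ T → s u ≠ s v := by
    intro u v huv hv heq
    -- From equal configurations the computation proceeds equally, so `s (u + (T - v))` is halting.
    have : ∀ r, v + r ≤ T → s (u + r) = s (v + r) := by
      intro r
      induction r with
      | zero => exact fun _ => heq
      | succ r ih =>
        intro hr
        have h₁ := hs (u + r) (by omega)
        have h₂ := hs (v + r) (by omega)
        rw [ih (by omega)] at h₁
        exact h₁.deterministic h₂
    have h := this (T - v) (by omega)
    rw [show v + (T - v) = T by omega] at h
    have h' := hs (u + (T - v)) (by omega)
    rw [h] at h'
    exact hT _ h'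
  intro u v huv
  rcases lt_trichotomy u v with h | h | h
  · exact absurd huv (key u v h (by omega))
  · exact h
  · exact absurd huv.symm (key v u h (by omega))

theorem messageCount_pos {M : Type*} {m₁ m₂ : Option M} (h : m₁ ≠ none ∨ m₂ ≠ none) :
    1 ≤ messageCount m₁ m₂ := by
  cases m₁ <;> cases m₂ <;> simp_all [messageCount]

/-- An accepting computation is a trace whose length is bounded by the number of configurations, and
which sends messages at no more than `f |w|` times. -/
theorem CommBoundedBy.exists_trace {R : A.Reverse} {f : ℕ → ℕ} (h : A.CommBoundedBy R f)
    (hw : w ∈ A.language) : ∃ T a b, A.Trace w T a b ∧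
      T < Nat.card A.Q₁ * Nat.card A.Q₂ * (w.length + 2) ^ 2 ∧
      {t | t ≤ T ∧ (A.msg₁ w (a t) ≠ none ∨ A.msg₂ w (b t) ≠ none)}.ncard ≤ f w.length := by
  have := A.finiteQ₁
  have := A.finiteQ₂
  obtain ⟨C, hH, hA, ⟨k, hr, hk⟩, -⟩ := h w hw
  obtain ⟨T, s, h0, rfl, hs, rfl⟩ := hr.exists_seq
  refine ⟨T, fun t => ((s t).state₁, (s t).head₁), fun t => ((s t).state₂, (s t).head₂),
    ⟨by simp [h0, init], by simp [h0, init], fun t ht => ?_, fun t ht => ?_,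
      fun t _ => (s t).head₁.isLt, fun t _ => (s t).head₂.isLt, ?_, hA⟩, ?_, ?_⟩
  · obtain ⟨d₁, d₂, e₁, e₂, f₁, f₂⟩ := hs t ht
    exact ⟨d₁, e₁, f₁⟩
  · obtain ⟨d₁, d₂, e₁, e₂, f₁, f₂⟩ := hs t ht
    exact ⟨d₂, e₂, f₂⟩
  · by_contra hcon
    simp only [Blocked₁, Blocked₂, not_or, not_forall, not_not, not_lt] at hcon
    obtain ⟨⟨y, ⟨d₁, e₁, f₁⟩, hy⟩, z, d₂, e₂, f₂⟩ := hcon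
    have := (s T).head₂.isLt
    refine hH ⟨y.1, z.1, ⟨y.2, by omega⟩, ⟨z.2, ?_⟩⟩ ⟨d₁, d₂, e₁, e₂, f₁, f₂⟩
    simp only at f₂
    omega
  · have hinj : Function.Injective fun t : Fin (T + 1) =>
        ((s t).state₁, (s t).state₂, (s t).head₁, (s t).head₂) := by
      intro u v huv
      simp only [Prod.mk.injEq] at huv
      exact seq_injOn hs hH (Config.ext huv.1 huv.2.1 huv.2.2.1 huv.2.2.2)
    have := Nat.card_le_card_of_injective _ hinj
    simp only [Nat.card_prod, Nat.card_fin] at this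
    calc T < T + 1 := Nat.lt_succ_self _
      _ ≤ _ := this
      _ = _ := by ring
  · have hset : {t | t ≤ T ∧ (A.msg₁ w ((s t).state₁, ((s t).head₁ : ℕ)) ≠ none ∨
        A.msg₂ w ((s t).state₂, ((s t).head₂ : ℕ)) ≠ none)} ⊆
        ((Finset.range (T + 1)).filter fun t => 1 ≤ A.sent w (s t) : Finset ℕ) := by
      rintro t ⟨ht, hm⟩
      simp only [Finset.coe_filter, Finset.mem_range, Set.mem_ofPred_eq]
      exact ⟨by omega, messageCount_pos hm⟩
    calc _ ≤ ((Finset.range (T + 1)).filter fun t => 1 ≤ A.sent w (s t)).card := by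
          rw [← Set.ncard_coe_finset]; exact Set.ncard_le_ncard hset (Finset.finite_toSet _)
      _ = ∑ t ∈ Finset.range (T + 1) with 1 ≤ A.sent w (s t), 1 := by simp
      _ ≤ ∑ t ∈ Finset.range (T + 1) with 1 ≤ A.sent w (s t), A.sent w (s t) :=
          Finset.sum_le_sum fun t ht => (Finset.mem_filter.1 ht).2
      _ ≤ ∑ t ∈ Finset.range (T + 1), A.sent w (s t) :=
          Finset.sum_le_sum_of_subset (Finset.filter_subset _ _)
      _ = _ := Finset.sum_range_succ _ _
      _ ≤ _ := hk

end DPWK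

/-! ### Fooling sets -/

/-- Two sequences that leave a region at the same times and into the same points, and do not return,
can be spliced: the first one is used inside, and the second one outside. -/
theorem splice {X : Type*} (side : X → Prop) {a b : ℕ → X} {T : ℕ} (h0 : a 0 = b 0)
    (ra : ∀ t < T, ¬ side (a t) → ¬ side (a (t + 1)))
    (rb : ∀ t < T, ¬ side (b t) → ¬ side (b (t + 1)))
    (hiff : ∀ t < T, (side (a t) ∧ ¬ side (a (t + 1))) ↔ (side (b t) ∧ ¬ side (b (t + 1))))
    (heq : ∀ t < T, side (a t) → ¬ side (a (t + 1)) → side (b t) → ¬ side (b (t + 1)) →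
      a (t + 1) = b (t + 1)) :
    ∃ c : ℕ → X, c 0 = a 0 ∧ (∀ t ≤ T, (side (a t) ∧ c t = a t) ∨ (¬ side (b t) ∧ c t = b t)) ∧
      ∀ t < T, (side (a t) ∧ c t = a t ∧ c (t + 1) = a (t + 1)) ∨
        (¬ side (b t) ∧ c t = b t ∧ c (t + 1) = b (t + 1)) := by
  classical
  have hs : ∀ t ≤ T, side (a t) ↔ side (b t) := by
    intro t
    induction t with
    | zero => intro _; rw [h0]
    | succ t ih =>
      intro ht
      have := ih (by omega)
      have := hiff t ht
      have := ra t ht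
      have := rb t ht
      tauto
  refine ⟨fun t => if side (a t) then a t else b t, by simp [h0], fun t ht => ?_, fun t ht => ?_⟩
  · by_cases h : side (a t)
    · exact Or.inl ⟨h, by simp [h]⟩
    · exact Or.inr ⟨by rwa [← hs t ht], by simp [h]⟩
  · have h₁ := hs t ht.le
    have h₂ := hs (t + 1) ht
    by_cases h : side (a t)
    · refine Or.inl ⟨h, by simp [h], ?_⟩
      by_cases h' : side (a (t + 1))
      · simp [h']
      · simp only [h', if_false]
        exact (heq t ht h h' (h₁.1 h) (by rwa [← h₂])).symm
    · refine Or.inr ⟨by rwa [← h₁], by simp [h], ?_⟩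
      simp [ra t ht h]

theorem tape_append_left {u v v' : List α} {x : ℕ} (h : x ≤ u.length) :
    tape (u ++ v) x = tape (u ++ v') x := by
  cases x with
  | zero => rfl
  | succ x => simp only [tape, List.getElem?_append_left (show x < u.length by omega)]

theorem tape_append_right {u u' v : List α} {x : ℕ} (hu : u.length = u'.length)
    (h : u.length < x) : tape (u ++ v) x = tape (u' ++ v) x := by
  obtain ⟨x, rfl⟩ : ∃ y, x = y + 1 := ⟨x - 1, by omega⟩
  simp only [tape]
  rw [List.getElem?_append_right (by omega), List.getElem?_append_right (by omega), hu]

/-- What an outside observer records of a computation at some time: the two messages, the states in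
which the components cross a fixed border, and, at the end, which components are blocked and which
are accepting. -/
abbrev Event (A : DPWK α) : Type :=
  (Option A.M × Option A.M) × Option A.Q₁ × Option A.Q₂ × Option (Prop × Prop × Prop × Prop)

open Classical in
/-- The event at time `t` of a trace of length `T`; the border is between the positions `c` and
`c + 1`. Behind the end of the trace nothing is recorded. -/
noncomputable def event (A : DPWK α) (w : List α) (c T : ℕ) (a : ℕ → A.Q₁ × ℕ)
    (b : ℕ → A.Q₂ × ℕ) (t : ℕ) : Event A :=
  if t ≤ T then
    ((A.msg₁ w (a t), A.msg₂ w (b t)),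
      if t < T ∧ (a t).2 ≤ c ∧ ¬ (a (t + 1)).2 ≤ c then some (a (t + 1)).1 else none,
      if t < T ∧ c < (b t).2 ∧ ¬ c < (b (t + 1)).2 then some (b (t + 1)).1 else none,
      if t = T then some (A.Blocked₁ w w.length (A.msg₂ w (b t)) (a t),
        A.Blocked₂ w (A.msg₁ w (a t)) (b t), (a t).1 ∈ A.F₁, (b t).1 ∈ A.F₂) else none)
  else ((none, none), none, none, none)

theorem ncard_le_one_of_crossing {T : ℕ} (p : ℕ → Prop) (hp : ∀ t < T, ¬ p t → ¬ p (t + 1)) :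
    {t | t < T ∧ p t ∧ ¬ p (t + 1)}.ncard ≤ 1 := by
  have hmono : ∀ t u, t ≤ u → u ≤ T → ¬ p t → ¬ p u := by
    intro t u htu
    induction u, htu using Nat.le_induction with
    | base => exact fun _ h => h
    | succ u _ ih => exact fun hu h => hp u hu (ih (by omega) h)
  have hlt : ∀ t u, u < T → ¬ p (t + 1) → p u → ¬ t < u := fun t u hu h h' htu =>
    hmono (t + 1) u htu hu.le h h'
  rw [Set.ncard_le_one_iff (Set.Finite.subset (Set.finite_lt_nat T) fun t h => h.1)]
  rintro t u ⟨ht, h₁, h₂⟩ ⟨hu, h₃, h₄⟩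
  have := hlt t u hu h₂ h₃
  have := hlt u t ht h₄ h₁
  omega

variable {A : DPWK α} {w : List α} {T : ℕ} {a : ℕ → A.Q₁ × ℕ} {b : ℕ → A.Q₂ × ℕ}

theorem DPWK.Adv₁.mono {m : Option A.M} {x y : A.Q₁ × ℕ} (h : A.Adv₁ w m x y) :
    x.2 ≤ y.2 ∧ y.2 ≤ x.2 + 1 := by
  obtain ⟨d, -, h⟩ := h
  cases d <;> simp only [Move.dist] at h <;> omega

theorem DPWK.Adv₂.mono {m : Option A.M} {x y : A.Q₂ × ℕ} (h : A.Adv₂ w m x y) :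
    y.2 ≤ x.2 ∧ x.2 ≤ y.2 + 1 := by
  obtain ⟨d, -, h⟩ := h
  cases d <;> simp only [Move.dist] at h <;> omega

theorem DPWK.Trace.ncard_event_le (h : A.Trace w T a b) (c : ℕ) :
    {t | event A w c T a b t ≠ ((none, none), none, none, none)}.ncard ≤
      {t | t ≤ T ∧ (A.msg₁ w (a t) ≠ none ∨ A.msg₂ w (b t) ≠ none)}.ncard + 3 := by
  have h₁ : {t | t < T ∧ (a t).2 ≤ c ∧ ¬ (a (t + 1)).2 ≤ c}.ncard ≤ 1 :=
    ncard_le_one_of_crossing (fun t => (a t).2 ≤ c) fun t ht hn => by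
      have := (h.step₁ t ht).mono
      omega
  have h₂ : {t | t < T ∧ c < (b t).2 ∧ ¬ c < (b (t + 1)).2}.ncard ≤ 1 :=
    ncard_le_one_of_crossing (fun t => c < (b t).2) fun t ht hn => by
      have := (h.step₂ t ht).mono
      omega
  have hsub : {t | event A w c T a b t ≠ ((none, none), none, none, none)} ⊆
      (({t | t ≤ T ∧ (A.msg₁ w (a t) ≠ none ∨ A.msg₂ w (b t) ≠ none)} ∪
        {t | t < T ∧ (a t).2 ≤ c ∧ ¬ (a (t + 1)).2 ≤ c}) ∪
        {t | t < T ∧ c < (b t).2 ∧ ¬ c < (b (t + 1)).2}) ∪ {T} := by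
    intro t ht
    by_contra hcon
    simp only [Set.mem_union, Set.mem_ofPred_eq, Set.mem_singleton_iff, not_or] at hcon
    obtain ⟨⟨⟨k₁, k₂⟩, k₃⟩, k₄⟩ := hcon
    apply ht
    unfold event
    split_ifs with hT
    · have : A.msg₁ w (a t) = none ∧ A.msg₂ w (b t) = none := by tauto
      simp [this.1, this.2]
    · rfl
  have hfin : ∀ s : Set ℕ, s ⊆ {t | t ≤ T} → s.Finite := fun s hs =>
    (Set.finite_le_nat T).subset hs
  refine (Set.ncard_le_ncard hsub ?_).trans ?_
  · refine hfin _ ?_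
    rintro t (((ht | ht) | ht) | ht)
    · exact ht.1
    · exact ht.1.le
    · exact ht.1.le
    · exact le_of_eq ht
  · have e₁ := Set.ncard_union_le (({t | t ≤ T ∧ (A.msg₁ w (a t) ≠ none ∨ A.msg₂ w (b t) ≠ none)} ∪
        {t | t < T ∧ (a t).2 ≤ c ∧ ¬ (a (t + 1)).2 ≤ c}) ∪
        {t | t < T ∧ c < (b t).2 ∧ ¬ c < (b (t + 1)).2}) {T}
    have e₂ := Set.ncard_union_le ({t | t ≤ T ∧ (A.msg₁ w (a t) ≠ none ∨ A.msg₂ w (b t) ≠ none)} ∪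
        {t | t < T ∧ (a t).2 ≤ c ∧ ¬ (a (t + 1)).2 ≤ c})
        {t | t < T ∧ c < (b t).2 ∧ ¬ c < (b (t + 1)).2}
    have e₃ := Set.ncard_union_le
      {t | t ≤ T ∧ (A.msg₁ w (a t) ≠ none ∨ A.msg₂ w (b t) ≠ none)}
      {t | t < T ∧ (a t).2 ≤ c ∧ ¬ (a (t + 1)).2 ≤ c}
    rw [Set.ncard_singleton] at e₁
    omega

theorem length_le_of_event_eq {w' : List α} {T' c : ℕ} {a' : ℕ → A.Q₁ × ℕ} {b' : ℕ → A.Q₂ × ℕ}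
    (h : event A w c T a b = event A w' c T' a' b') : T ≤ T' := by
  by_contra hlt
  have := congrFun h T
  simp [event, show ¬ T ≤ T' from hlt] at this

/-- If two accepting computations yield the same events, then the word composed of the left part of
the first input and the right part of the second one is accepted, too. -/
theorem mem_language_of_event_eq {u v u' v' : List α} (hu : u.length = u'.length)
    (hv : v.length = v'.length) {T' : ℕ} {a' : ℕ → A.Q₁ × ℕ} {b' : ℕ → A.Q₂ × ℕ}
    (h : A.Trace (u ++ v) T a b) (h' : A.Trace (u' ++ v') T' a' b')
    (he : event A (u ++ v) u.length T a b = event A (u' ++ v') u.length T' a' b') :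
    u ++ v' ∈ A.language := by
  obtain rfl : T = T' := le_antisymm (length_le_of_event_eq he) (length_le_of_event_eq he.symm)
  have hl : ∀ {x}, x ≤ u.length → tape (u ++ v') x = tape (u ++ v) x := fun hx =>
    tape_append_left hx
  have hr : ∀ {x}, ¬ x ≤ u.length → tape (u ++ v') x = tape (u' ++ v') x := fun hx =>
    tape_append_right hu (not_le.1 hx)
  have hlen : (u ++ v).length = (u ++ v').length := by simp [hv]
  have hlen' : (u' ++ v').length = (u ++ v').length := by simp [hu]
  have ev : ∀ t ≤ T, event A (u ++ v) u.length T a b t = event A (u' ++ v') u.length T a' b' t :=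
    fun t _ => congrFun he t
  simp only [event] at ev
  have evm : ∀ t ≤ T, A.msg₁ (u ++ v) (a t) = A.msg₁ (u' ++ v') (a' t) ∧
      A.msg₂ (u ++ v) (b t) = A.msg₂ (u' ++ v') (b' t) := by
    intro t ht
    have := ev t ht
    simp only [if_pos ht, Prod.mk.injEq] at this
    exact this.1
  have evc₁ : ∀ t < T, (((a t).2 ≤ u.length ∧ ¬ (a (t + 1)).2 ≤ u.length) ↔
      ((a' t).2 ≤ u.length ∧ ¬ (a' (t + 1)).2 ≤ u.length)) ∧
      ((a t).2 ≤ u.length → ¬ (a (t + 1)).2 ≤ u.length → (a' t).2 ≤ u.length →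
        ¬ (a' (t + 1)).2 ≤ u.length → (a (t + 1)).1 = (a' (t + 1)).1) := by
    intro t ht
    have := ev t ht.le
    simp only [if_pos ht.le, Prod.mk.injEq] at this
    have := this.2.1
    simp only [ht, true_and] at this
    refine ⟨?_, fun k₁ k₂ k₃ k₄ => ?_⟩
    · split_ifs at this <;> tauto
    · simpa [k₁, k₂, k₃, k₄] using this
  have evc₂ : ∀ t < T, ((u.length < (b t).2 ∧ ¬ u.length < (b (t + 1)).2) ↔
      (u.length < (b' t).2 ∧ ¬ u.length < (b' (t + 1)).2)) ∧
      (u.length < (b t).2 → ¬ u.length < (b (t + 1)).2 → u.length < (b' t).2 →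
        ¬ u.length < (b' (t + 1)).2 → (b (t + 1)).1 = (b' (t + 1)).1) := by
    intro t ht
    have := ev t ht.le
    simp only [if_pos ht.le, Prod.mk.injEq] at this
    have := this.2.2.1
    simp only [ht, true_and] at this
    refine ⟨?_, fun k₁ k₂ k₃ k₄ => ?_⟩
    · split_ifs at this <;> tauto
    · simpa [k₁, k₂, k₃, k₄] using this
  have evf := ev T le_rfl
  simp only [le_refl, if_true, Prod.mk.injEq, Option.some_inj] at evf
  obtain ⟨-, -, -, evb₁, evb₂, eva₁, eva₂⟩ := evf
  obtain ⟨p, hp0, hpt, hps⟩ := splice (fun x : A.Q₁ × ℕ => x.2 ≤ u.length) (a := a) (b := a')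
    (T := T) (h.start₁.trans h'.start₁.symm)
    (fun t ht hn => by have := (h.step₁ t ht).mono; omega)
    (fun t ht hn => by have := (h'.step₁ t ht).mono; omega)
    (fun t ht => (evc₁ t ht).1)
    (fun t ht k₁ k₂ k₃ k₄ => by
      have := (h.step₁ t ht).mono
      have := (h'.step₁ t ht).mono
      exact Prod.ext ((evc₁ t ht).2 k₁ k₂ k₃ k₄) (by omega))
  obtain ⟨q, hq0, hqt, hqs⟩ := splice (fun x : A.Q₂ × ℕ => u.length < x.2) (a := b') (b := b)
    (T := T) (by rw [h.start₂, h'.start₂, hlen, hlen'])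
    (fun t ht hn => by have := (h'.step₂ t ht).mono; omega)
    (fun t ht hn => by have := (h.step₂ t ht).mono; omega)
    (fun t ht => (evc₂ t ht).1.symm)
    (fun t ht k₁ k₂ k₃ k₄ => by
      have := (h.step₂ t ht).mono
      have := (h'.step₂ t ht).mono
      exact Prod.ext ((evc₂ t ht).2 k₃ k₄ k₁ k₂).symm (by omega))
  have m₁ : ∀ t ≤ T, A.msg₁ (u ++ v') (p t) = A.msg₁ (u ++ v) (a t) := by
    intro t ht
    rcases hpt t ht with ⟨k, e⟩ | ⟨k, e⟩
    · rw [e]; simp only [DPWK.msg₁, hl k]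
    · rw [e, (evm t ht).1]; simp only [DPWK.msg₁, hr k]
  have m₂ : ∀ t ≤ T, A.msg₂ (u ++ v') (q t) = A.msg₂ (u ++ v) (b t) := by
    intro t ht
    rcases hqt t ht with ⟨k, e⟩ | ⟨k, e⟩
    · rw [e, (evm t ht).2]; simp only [DPWK.msg₂, hr (not_le.2 k)]
    · rw [e]; simp only [DPWK.msg₂, hl (not_lt.1 k)]
  have A₁l : ∀ {m x y}, x.2 ≤ u.length → (A.Adv₁ (u ++ v') m x y ↔ A.Adv₁ (u ++ v) m x y) := by
    intro m x y hx; simp only [DPWK.Adv₁, hl hx]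
  have A₁r : ∀ {m x y}, ¬ x.2 ≤ u.length →
      (A.Adv₁ (u ++ v') m x y ↔ A.Adv₁ (u' ++ v') m x y) := by
    intro m x y hx; simp only [DPWK.Adv₁, hr hx]
  have A₂l : ∀ {m x y}, ¬ u.length < x.2 → (A.Adv₂ (u ++ v') m x y ↔ A.Adv₂ (u ++ v) m x y) := by
    intro m x y hx; simp only [DPWK.Adv₂, hl (not_lt.1 hx)]
  have A₂r : ∀ {m x y}, u.length < x.2 →
      (A.Adv₂ (u ++ v') m x y ↔ A.Adv₂ (u' ++ v') m x y) := by
    intro m x y hx; simp only [DPWK.Adv₂, hr (not_le.2 hx)]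
  refine DPWK.Trace.mem_language (T := T) (a := p) (b := q)
    ⟨hp0.trans h.start₁, by rw [hq0, h'.start₂, hlen'], fun t ht => ?_, fun t ht => ?_,
      fun t ht => ?_, fun t ht => ?_, ?_, ?_⟩
  · rw [m₂ t ht.le]
    rcases hps t ht with ⟨k, e₁, e₂⟩ | ⟨k, e₁, e₂⟩
    · rw [e₁, e₂, A₁l k]; exact h.step₁ t ht
    · rw [e₁, e₂, A₁r k, (evm t ht.le).2]; exact h'.step₁ t ht
  · rw [m₁ t ht.le]
    rcases hqs t ht with ⟨k, e₁, e₂⟩ | ⟨k, e₁, e₂⟩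
    · rw [e₁, e₂, A₂r k, (evm t ht.le).1]; exact h'.step₂ t ht
    · rw [e₁, e₂, A₂l k]; exact h.step₂ t ht
  · rcases hpt t ht with ⟨k, e⟩ | ⟨k, e⟩
    · rw [e, ← hlen]; exact h.bound₁ t ht
    · rw [e, ← hlen']; exact h'.bound₁ t ht
  · rcases hqt t ht with ⟨k, e⟩ | ⟨k, e⟩
    · rw [e, ← hlen']; exact h'.bound₂ t ht
    · rw [e, ← hlen]; exact h.bound₂ t ht
  · have b₁ : A.Blocked₁ (u ++ v') (u ++ v').length (A.msg₂ (u ++ v') (q T)) (p T) =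
        A.Blocked₁ (u ++ v) (u ++ v).length (A.msg₂ (u ++ v) (b T)) (a T) := by
      rw [m₂ T le_rfl]
      rcases hpt T le_rfl with ⟨k, e⟩ | ⟨k, e⟩
      · rw [e, hlen]; simp only [DPWK.Blocked₁, A₁l k]
      · rw [e, evb₁, ← hlen', (evm T le_rfl).2]; simp only [DPWK.Blocked₁, A₁r k]
    have b₂ : A.Blocked₂ (u ++ v') (A.msg₁ (u ++ v') (p T)) (q T) =
        A.Blocked₂ (u ++ v) (A.msg₁ (u ++ v) (a T)) (b T) := by
      rw [m₁ T le_rfl]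
      rcases hqt T le_rfl with ⟨k, e⟩ | ⟨k, e⟩
      · rw [e, evb₂, (evm T le_rfl).1]; simp only [DPWK.Blocked₂, A₂r k]
      · rw [e]; simp only [DPWK.Blocked₂, A₂l k]
    rw [b₁, b₂]
    exact h.halt
  · have c₁ : ((p T).1 ∈ A.F₁) = ((a T).1 ∈ A.F₁) := by
      rcases hpt T le_rfl with ⟨-, e⟩ | ⟨-, e⟩
      · rw [e]
      · rw [e, eva₁]
    have c₂ : ((q T).1 ∈ A.F₂) = ((b T).1 ∈ A.F₂) := by
      rcases hqt T le_rfl with ⟨-, e⟩ | ⟨-, e⟩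
      · rw [e, eva₂]
      · rw [e]
    rw [c₁, c₂]
    exact h.accept

theorem card_le_of_injective_finset {ι β : Type*} [Finite ι] [Finite β] {k : ℕ}
    (F : ι → Finset β) (hF : Function.Injective F) (hk : ∀ i, (F i).card ≤ k) :
    Nat.card ι ≤ (Nat.card β + 1) ^ k := by
  have hinj : Function.Injective fun i => fun x : Fin k => (F i).toList[(x : ℕ)]? := by
    intro i j hij
    refine hF (Finset.ext fun y => ?_)
    have hmem : ∀ i, y ∈ F i ↔ ∃ x : Fin k, (F i).toList[(x : ℕ)]? = some y := by
      intro i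
      rw [← Finset.mem_toList, List.mem_iff_getElem?]
      refine ⟨fun ⟨x, hx⟩ => ?_, fun ⟨x, hx⟩ => ⟨x, hx⟩⟩
      obtain ⟨hlt, -⟩ := List.getElem?_eq_some_iff.1 hx
      rw [Finset.length_toList] at hlt
      exact ⟨⟨x, hlt.trans_le (hk i)⟩, hx⟩
    rw [hmem, hmem]
    refine exists_congr fun x => ?_
    have := congrFun hij x
    simp only at this
    rw [this]
  have := Nat.card_le_card_of_injective _ hinj
  simpa [Nat.card_fun, Finite.card_option] using this

theorem card_le_of_events {ι E : Type*} [Finite ι] [Finite E] {N k : ℕ} (z : E) (ev : ι → ℕ → E)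
    (hinj : Function.Injective ev) (hN : ∀ i t, ev i t ≠ z → t < N)
    (hk : ∀ i, {t | ev i t ≠ z}.ncard ≤ k) : Nat.card ι ≤ (N * Nat.card E + 1) ^ k := by
  classical
  have := Fintype.ofFinite E
  let F : ι → Finset (Fin N × E) := fun i =>
    Finset.univ.filter fun x => ev i x.1 = x.2 ∧ x.2 ≠ z
  have hF : Function.Injective F := by
    have key : ∀ i j, F i = F j → ∀ t, ev i t ≠ z → ev j t = ev i t := by
      intro i j hij t ht
      have : ((⟨t, hN i t ht⟩, ev i t) : Fin N × E) ∈ F j := by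
        rw [← hij]; simp [F, ht]
      exact (Finset.mem_filter.1 this).2.1
    intro i j hij
    refine hinj (funext fun t => ?_)
    by_cases hi : ev i t = z
    · by_cases hj : ev j t = z
      · rw [hi, hj]
      · exact key j i hij.symm t hj
    · exact (key i j hij t hi).symm
  have hcard : ∀ i, (F i).card ≤ k := by
    intro i
    refine le_trans ?_ (hk i)
    rw [← Set.ncard_coe_finset]
    refine Set.ncard_le_ncard_of_injOn (fun x => (x.1 : ℕ)) ?_ ?_
      ((Set.finite_lt_nat N).subset fun t ht => hN i t ht)
    · intro x hx
      have := (Finset.mem_filter.1 hx).2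
      show ev i x.1 ≠ z
      rw [this.1]; exact this.2
    · intro x hx y hy hxy
      have h₁ := (Finset.mem_filter.1 hx).2.1
      have h₂ := (Finset.mem_filter.1 hy).2.1
      have h₃ : x.1 = y.1 := Fin.ext hxy
      exact Prod.ext h₃ (by rw [← h₁, ← h₂, h₃])
  simpa [Nat.card_prod] using card_le_of_injective_finset F hF hcard

/-- The size of a fooling set is bounded in terms of the communication. -/
theorem DPWK.exists_card_fooling_le (A : DPWK α) : ∃ K : ℕ, 0 < K ∧ ∀ (R : A.Reverse) (f : ℕ → ℕ),
    A.CommBoundedBy R f → ∀ (ι : Type) [Finite ι] (u v : ι → List α) (n c : ℕ),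
      (∀ i, (u i).length = c) → (∀ i, (u i ++ v i).length = n) →
      (∀ i, u i ++ v i ∈ A.language) → (∀ i j, i ≠ j → u i ++ v j ∉ A.language) →
      Nat.card ι ≤ (K * (n + 2) ^ 2) ^ (f n + 3) := by
  have := A.finiteM
  have := A.finiteQ₁
  have := A.finiteQ₂
  refine ⟨Nat.card A.Q₁ * Nat.card A.Q₂ * Nat.card (Event A) + 1, Nat.succ_pos _,
    fun R f hf ι _ u v n c hu hn hmem hnot => ?_⟩
  choose T a b htr hT hmsg using fun i => hf.exists_trace (hmem i)
  have hev := card_le_of_events (N := Nat.card A.Q₁ * Nat.card A.Q₂ * (n + 2) ^ 2) (k := f n + 3)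
    ((none, none), none, none, none) (fun i => event A (u i ++ v i) c (T i) (a i) (b i)) ?_ ?_ ?_
  · refine hev.trans (Nat.pow_le_pow_left ?_ _)
    have : 1 ≤ (n + 2) ^ 2 := Nat.one_le_pow _ _ (by omega)
    calc _ ≤ Nat.card A.Q₁ * Nat.card A.Q₂ * (n + 2) ^ 2 * Nat.card (Event A) + (n + 2) ^ 2 := by
          gcongr
      _ = _ := by ring
  · intro i j hij
    by_contra hne
    have hlen : (v i).length = (v j).length := by
      have h₁ := hn i
      have h₂ := hn j
      rw [List.length_append, hu] at h₁ h₂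
      omega
    refine hnot i j hne
      (mem_language_of_event_eq ((hu i).trans (hu j).symm) hlen (htr i) (htr j) ?_)
    rw [hu i]; exact hij
  · intro i t ht
    by_contra hlt
    have h₁ := hT i
    rw [hn i] at h₁
    exact ht (by simp [event, show ¬ t ≤ T i by omega])
  · intro i
    have h₁ := (htr i).ncard_event_le c
    have h₂ := hmsg i
    rw [hn i] at h₂
    omega

end LowerBound

/-! ### Bounds on the number of marks -/

/-- At time `t` the lower component is on cell `⌊t / 2⌋`; hence doubling the distance adds at most
one mark. -/
theorem marks_le_of_sparse_always {β : ℕ → Bool} {m : ℕ} (h : Sparse (fun _ => true) β m) :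
    ∀ t ≤ m, 2 ^ marks β t ≤ max 1 (2 * t) := by
  intro t
  induction t using Nat.strong_induction_on with
  | _ t ih =>
    intro ht
    obtain ⟨q, h₁, h₂⟩ := exists_arrival (fun _ => true) β t
    have hle := h t ht q h₁ h₂
    have harr : arrival (fun _ => true) β q = q + q := by
      rw [arrival, Nat.count_of_forall (by simp)]
    rcases Nat.eq_zero_or_pos t with rfl | hpos
    · simp [marks]
    have hq := ih q (by omega) (by omega)
    have h3 : 2 ^ marks β t ≤ 2 * 2 ^ marks β q := by
      rw [← pow_succ']; exact Nat.pow_le_pow_right two_pos hle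
    omega

/-- At time `t` the lower component has read `q` cells with `q + marks β q ≤ t`. So the next mark
comes at least `marks β q` cells later, and the gaps add up to a quadratic bound. -/
theorem marks_le_of_sparse_id {β : ℕ → Bool} {m : ℕ} (h : Sparse id β m) :
    ∀ t ≤ m, marks β t * marks β t ≤ 2 * t + marks β t := by
  intro t
  induction t using Nat.strong_induction_on with
  | _ t ih =>
    intro ht
    obtain ⟨q, h₁, h₂⟩ := exists_arrival id β t
    have hle := h t ht q h₁ h₂
    have harr : arrival id β q = q + marks β q := rfl
    have hmono := marks_mono β ((le_arrival id β q).trans h₁)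
    rcases Nat.lt_or_ge q t with hlt | hge
    · have hq := ih q hlt (by omega)
      rcases (show marks β t = marks β q ∨ marks β t = marks β q + 1 by omega) with e | e
      · rw [e]; omega
      · rw [e]; nlinarith
    · obtain rfl : q = t := by omega
      have : marks β q = 0 := by omega
      simp [this]

/-! ### Families of sparse palindromes -/

/-- If there are no two marks at positions `q, …, t - 1`, then at most one mark is counted there. -/
theorem marks_le_succ {β : ℕ → Bool} {q t : ℕ} (hqt : q ≤ t)
    (h : ∀ p p', q ≤ p → p < p' → p' < t → β p = true → β p' = true → False) :
    marks β t ≤ marks β q + 1 := by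
  have key : marks β t = marks β q ∨
      (marks β t = marks β q + 1 ∧ ∃ p, q ≤ p ∧ p < t ∧ β p = true) := by
    induction t, hqt using Nat.le_induction with
    | base => exact Or.inl rfl
    | succ t hqt ih =>
      have := ih fun p p' h₁ h₂ h₃ => h p p' h₁ h₂ (by omega)
      rw [marks_succ]
      cases hb : β t with
      | false =>
        rcases this with e | ⟨e, p, h₁, h₂, h₃⟩
        · exact Or.inl (by simpa using e)
        · exact Or.inr ⟨by simpa using e, p, h₁, by omega, h₃⟩
      | true =>
        rcases this with e | ⟨e, p, h₁, h₂, h₃⟩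
        · exact Or.inr ⟨by simp [e], t, hqt, by omega, hb⟩
        · exact (h p t h₁ h₂ (by omega) h₃ hb).elim
  omega

open Classical in
/-- The pattern with one mark in each of `r` windows of width `W`: the `i`-th window starts at the
position `o i`, and `k i` tells the place of its mark. -/
noncomputable def pattern (o : ℕ → ℕ) {r W : ℕ} (k : Fin r → Fin W) (p : ℕ) : Bool :=
  decide (∃ i : Fin r, p = o i + k i)

variable {o : ℕ → ℕ} {r W m : ℕ}

theorem pattern_eq_true {k : Fin r → Fin W} {p : ℕ} :
    pattern o k p = true ↔ ∃ i : Fin r, p = o i + k i := by simp [pattern]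

theorem window_le (ho : ∀ i, o i + W ≤ o (i + 1)) {i j : ℕ} (h : i < j) : o (i + 1) ≤ o j :=
  monotone_nat_of_le_succ (fun i => (Nat.le_add_right _ _).trans (ho i)) h

theorem pattern_injective (ho : ∀ i, o i + W ≤ o (i + 1)) (hm : ∀ i < r, o i + W ≤ m)
    {k k' : Fin r → Fin W} (h : ∀ p < m, pattern o k p = pattern o k' p) : k = k' := by
  funext i
  have hi := hm i i.2
  have h₁ := h (o i + k i) (by omega)
  rw [pattern_eq_true.2 ⟨i, rfl⟩] at h₁
  obtain ⟨j, hj⟩ := pattern_eq_true.1 h₁.symm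
  rcases lt_trichotomy i j with hij | rfl | hij
  · have := window_le ho (show (i : ℕ) < j from hij)
    have := ho i
    omega
  · exact Fin.ext (by omega)
  · have := window_le ho (show (j : ℕ) < i from hij)
    have := ho j
    omega

theorem marks_pattern_le (k : Fin r → Fin W) (q : ℕ) : marks (pattern o k) q ≤ r := by
  classical
  rw [marks, Nat.count_eq_card_filter_range]
  calc _ ≤ (Finset.univ.image fun i : Fin r => o i + (k i : ℕ)).card := by
        refine Finset.card_le_card fun p hp => ?_
        obtain ⟨i, hi⟩ := pattern_eq_true.1 (Finset.mem_filter.1 hp).2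
        exact Finset.mem_image.2 ⟨i, Finset.mem_univ _, hi.symm⟩
    _ ≤ r := Finset.card_image_le.trans (by simp)

/-- Two marks of a pattern lie in different windows. -/
theorem exists_window (ho : ∀ i, o i + W ≤ o (i + 1)) {k : Fin r → Fin W} {p p' : ℕ} (h : p < p')
    (hp : pattern o k p = true) (hp' : pattern o k p' = true) :
    ∃ i < r, p < o i + W ∧ o (i + 1) ≤ p' := by
  obtain ⟨i, hi⟩ := pattern_eq_true.1 hp
  obtain ⟨j, hj⟩ := pattern_eq_true.1 hp'
  refine ⟨i, i.2, by omega, ?_⟩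
  rcases lt_trichotomy i j with hij | rfl | hij
  · have := window_le ho (show (i : ℕ) < j from hij)
    omega
  · omega
  · have := window_le ho (show (j : ℕ) < i from hij)
    have := ho j
    omega

theorem sparse_always_pattern (ho : ∀ i, 2 * (o i + W) ≤ o (i + 1)) (k : Fin r → Fin W) :
    Sparse (fun _ => true) (pattern o k) m := by
  intro t _ q h₁ h₂
  have ho' : ∀ i, o i + W ≤ o (i + 1) := fun i => by have := ho i; omega
  have harr : arrival (fun _ => true) (pattern o k) (q + 1) = q + 1 + (q + 1) := by
    rw [arrival, Nat.count_of_forall (by simp)]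
  refine marks_le_succ ((le_arrival _ _ _).trans h₁) fun p p' hq hpp' ht hp hp' => ?_
  obtain ⟨i, -, hi, hi'⟩ := exists_window ho' hpp' hp hp'
  have := ho i
  omega

theorem sparse_id_pattern (ho : ∀ i, o i + W + r ≤ o (i + 1)) (k : Fin r → Fin W) :
    Sparse id (pattern o k) m := by
  intro t _ q h₁ h₂
  have ho' : ∀ i, o i + W ≤ o (i + 1) := fun i => by have := ho i; omega
  have harr : arrival id (pattern o k) q = q + marks (pattern o k) q := rfl
  have hr := marks_pattern_le (o := o) k q
  have hb := Bool.toNat_le (id (pattern o k q))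
  rw [arrival_succ, harr] at h₂
  refine marks_le_succ ((le_arrival _ _ _).trans h₁) fun p p' hq hpp' ht hp hp' => ?_
  obtain ⟨i, -, hi, hi'⟩ := exists_window ho' hpp' hp hp'
  have := ho i
  omega

theorem sparse_never (β : ℕ → Bool) (m : ℕ) : Sparse (fun _ => false) β m := by
  intro t _ q h₁ h₂
  have harr : ∀ q, arrival (fun _ => false) β q = q := by simp [arrival]
  rw [harr] at h₁ h₂
  obtain rfl : t = q := by omega
  omega

/-! ### The languages -/

variable {S : Type*}

instance : Nonempty Letter := ⟨.centre⟩

/-- The language of the machine with dwelling rule `dw`, with the letters written as symbols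
from `S`. -/
noncomputable def sparseLanguage (dw : Bool → Bool) (spell : Letter → S) : Language S :=
  Language.map Subtype.val
    (machine dw fun s : (Set.finite_range spell).toFinset => Function.invFun spell s.1).language

theorem mem_sparseLanguage_iff {dw : Bool → Bool} {spell : Letter → S}
    (hs : Function.Injective spell) {l : List Letter} :
    l.map spell ∈ sparseLanguage dw spell ↔ ∃ β m, l = pal β m ∧ Sparse dw β m := by
  have hinv : ∀ x, Function.invFun spell (spell x) = x := Function.leftInverse_invFun hs
  constructor
  · rintro ⟨w, hw, hwl⟩
    obtain ⟨β, m, h, hsp⟩ := mem_machine_language_iff.1 hw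
    refine ⟨β, m, ?_, hsp⟩
    have hwl : w.map Subtype.val = l.map spell := hwl
    calc l = (l.map spell).map (Function.invFun spell) := by
          rw [List.map_map]; exact (List.map_id'' (f := _ ∘ _) hinv l).symm
      _ = w.map fun s => Function.invFun spell s.1 := by rw [← hwl, List.map_map]; rfl
      _ = pal β m := h
  · rintro ⟨β, m, rfl, hsp⟩
    refine ⟨(pal β m).map fun x => ⟨spell x, by simp⟩, mem_machine_language_iff.2
      ⟨β, m, ?_, hsp⟩, ?_⟩
    · rw [List.map_map]; exact List.map_id'' (f := _ ∘ _) hinv _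
    · show List.map _ (List.map _ _) = _
      rw [List.map_map]; rfl

theorem sparseLanguage_mem {dw : Bool → Bool} {spell : Letter → S} {g : ℕ → ℝ} {f : ℕ → ℕ}
    (hf : f ∈ bigO g) (h : ∀ β m, Sparse dw β m → 2 * marks β m + 2 ≤ f (2 * m + 1)) :
    sparseLanguage dw spell ∈ revPWKFamily S g :=
  ⟨_, _, _, machine_reversible _ _, ⟨f, hf, machine_commBoundedBy_marks _ _ f h⟩, rfl⟩

/-- The fooling set bound for languages in one of the families. -/
theorem exists_card_fooling_le {g : ℕ → ℝ} {L : Language S} (hL : L ∈ revPWKFamily S g) :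
    ∃ f ∈ bigO g, ∃ K : ℕ, 0 < K ∧ ∀ (ι : Type) [Finite ι] (u v : ι → List S) (n c : ℕ),
      (∀ i, (u i).length = c) → (∀ i, (u i ++ v i).length = n) →
      (∀ i, u i ++ v i ∈ L) → (∀ i j, i ≠ j → u i ++ v j ∉ L) →
      Nat.card ι ≤ (K * (n + 2) ^ 2) ^ (f n + 3) := by
  obtain ⟨Γ, A, R, -, ⟨f, hf, hb⟩, rfl⟩ := hL
  obtain ⟨K, hK, h⟩ := A.exists_card_fooling_le
  refine ⟨f, hf, K, hK, fun ι _ u v n c hu hn hmem hnot => ?_⟩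
  have hsplit : ∀ i, ∃ x y : List Γ, x ++ y ∈ A.language ∧ x.map Subtype.val = u i ∧
      y.map Subtype.val = v i := by
    intro i
    obtain ⟨w, hw, hwi⟩ := hmem i
    obtain ⟨x, y, rfl, hx, hy⟩ := List.map_eq_append_iff.1 hwi
    exact ⟨x, y, hw, hx, hy⟩
  choose x y hxy hx hy using hsplit
  refine h R f hb ι x y n c (fun i => ?_) (fun i => ?_) hxy fun i j hij hmem' => ?_
  · rw [← hu i, ← hx i, List.length_map]
  · rw [← hn i, ← hx i, ← hy i, List.length_append, List.length_append, List.length_map,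
      List.length_map]
  · refine hnot i j hij ⟨_, hmem', ?_⟩
    rw [← hx i, ← hy j]
    exact List.map_append

theorem half_append_eq_pal {β β' β'' : ℕ → Bool} {m m' : ℕ}
    (h : (half β m).reverse ++ Letter.centre :: half β' m = pal β'' m') :
    ∀ p < m, β p = β' p := by
  have hlen := congrArg List.length h
  simp only [List.length_append, List.length_reverse, length_half, List.length_cons,
    length_pal] at hlen
  obtain rfl : m = m' := by omega
  obtain ⟨h₁, h₂⟩ := List.append_inj h (by simp)
  have h₃ : half β m = half β' m :=
    (List.reverse_injective h₁).trans (List.cons.inj h₂).2.symm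
  intro p hp
  have := congrArg (fun l : List Letter => l[p]?) h₃
  simpa [half_getElem? _ hp] using this

/-- The patterns with `r` windows of width `W` yield a fooling set of size `W ^ r`, in which the
words are cut behind the centre. -/
theorem pow_le_of_mem_family {dw : Bool → Bool} {spell : Letter → S}
    (hs : Function.Injective spell) {g : ℕ → ℝ}
    (hL : sparseLanguage dw spell ∈ revPWKFamily S g) :
    ∃ f ∈ bigO g, ∃ K : ℕ, 0 < K ∧ ∀ (o : ℕ → ℕ) (r W m : ℕ), (∀ i, o i + W ≤ o (i + 1)) →
      (∀ i < r, o i + W ≤ m) → (∀ k : Fin r → Fin W, Sparse dw (pattern o k) m) →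
      W ^ r ≤ (K * (2 * m + 3) ^ 2) ^ (f (2 * m + 1) + 3) := by
  obtain ⟨f, hf, K, hK, h⟩ := exists_card_fooling_le hL
  refine ⟨f, hf, K, hK, fun o r W m ho hm hsp => ?_⟩
  have happ : ∀ k k' : Fin r → Fin W,
      (((half (pattern o k) m).reverse ++ [Letter.centre]).map spell ++
        (half (pattern o k') m).map spell) =
      ((half (pattern o k) m).reverse ++ Letter.centre :: half (pattern o k') m).map spell := by
    intro k k'; simp
  have := h (Fin r → Fin W)
    (fun k => ((half (pattern o k) m).reverse ++ [Letter.centre]).map spell)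
    (fun k => (half (pattern o k) m).map spell) (2 * m + 1) (m + 1) (fun k => by simp)
    (fun k => by simp; omega)
    (fun k => by
      rw [happ, mem_sparseLanguage_iff hs]
      exact ⟨_, m, rfl, hsp k⟩)
    (fun k k' hkk' hmem => by
      rw [happ, mem_sparseLanguage_iff hs] at hmem
      obtain ⟨β, m', hβ, -⟩ := hmem
      exact hkk' (pattern_injective ho hm (half_append_eq_pal hβ)))
  simpa [Nat.card_fun] using this

/-! ### Asymptotics -/

theorem revPWKFamily_mono {g h : ℕ → ℝ} (hgh : g =O[atTop] h) :
    revPWKFamily S g ⊆ revPWKFamily S h := by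
  rintro L ⟨Γ, A, R, hR, ⟨f, hf, hb⟩, rfl⟩
  exact ⟨Γ, A, R, hR, ⟨f, IsBigO.trans hf hgh, hb⟩, rfl⟩

/-- If there are fooling sets of sizes `2 ^ P M` on words of lengths `n M`, then the communication
`g` with `g (n M) * log (n M) = o(P M)` does not suffice. -/
theorem not_mem_family {dw : Bool → Bool} {spell : Letter → S} (hs : Function.Injective spell)
    {g : ℕ → ℝ} (hg : (fun _ => (1 : ℝ)) =O[atTop] g) (o : ℕ → ℕ → ℕ) (r b m : ℕ → ℕ)
    (ho : ∀ M i, o M i + 2 ^ b M ≤ o M (i + 1)) (hm : ∀ M, ∀ i < r M, o M i + 2 ^ b M ≤ m M)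
    (hsp : ∀ M, ∀ k : Fin (r M) → Fin (2 ^ b M), Sparse dw (pattern (o M) k) (m M))
    (htop : Tendsto m atTop atTop) (hP : ∀ M, 0 < M → 0 < b M * r M)
    (hlit : (fun M => g (2 * m M + 1) * Real.log ((2 * m M + 1 : ℕ) : ℝ)) =o[atTop]
      fun M => ((b M * r M : ℕ) : ℝ)) :
    sparseLanguage dw spell ∉ revPWKFamily S g := by
  intro hL
  obtain ⟨f, hf, K, hK, h⟩ := pow_le_of_mem_family hs hL
  have hn : Tendsto (fun M => 2 * m M + 1) atTop atTop :=
    tendsto_atTop_mono (fun M => by omega) htop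
  have hlog : Tendsto (fun M => Real.log ((2 * m M + 1 : ℕ) : ℝ)) atTop atTop :=
    Real.tendsto_log_atTop.comp (tendsto_natCast_atTop_atTop.comp hn)
  have hle : ∀ M, ((b M * r M : ℕ) : ℝ) * Real.log 2 ≤
      ((f (2 * m M + 1) : ℝ) + 3) * (Real.log K + 2 * Real.log ((2 * m M + 3 : ℕ) : ℝ)) := by
    intro M
    have h₁ := h (o M) (r M) (2 ^ b M) (m M) (ho M) (hm M) (hsp M)
    rw [← pow_mul] at h₁
    have h₂ : (2 : ℝ) ^ (b M * r M) ≤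
        ((K : ℝ) * ((2 * m M + 3 : ℕ) : ℝ) ^ 2) ^ (f (2 * m M + 1) + 3) := by exact_mod_cast h₁
    have h₃ := Real.log_le_log (by positivity) h₂
    rw [Real.log_pow, Real.log_pow, Real.log_mul (by positivity) (by positivity),
      Real.log_pow] at h₃
    exact_mod_cast h₃
  have hf' : (fun M => (f (2 * m M + 1) : ℝ) + 3) =O[atTop] fun M => g (2 * m M + 1) := by
    have h₁ : (fun M => (f (2 * m M + 1) : ℝ)) =O[atTop] fun M => g (2 * m M + 1) :=
      IsBigO.comp_tendsto hf hn
    have h₂ : (fun _ : ℕ => (1 : ℝ)) =O[atTop] fun M => g (2 * m M + 1) := hg.comp_tendsto hn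
    exact h₁.add ((isBigO_const_const (3 : ℝ) one_ne_zero atTop).trans h₂)
  have hl' : (fun M => Real.log K + 2 * Real.log ((2 * m M + 3 : ℕ) : ℝ)) =O[atTop]
      fun M => Real.log ((2 * m M + 1 : ℕ) : ℝ) := by
    refine IsBigO.add ?_ (IsBigO.const_mul_left ?_ _)
    · exact (isLittleO_const_left.2 (Or.inr (tendsto_norm_atTop_atTop.comp hlog))).isBigO
    · refine IsBigO.of_bound 2 ?_
      filter_upwards [htop.eventually_ge_atTop 1] with M hM
      rw [Real.norm_of_nonneg (Real.log_natCast_nonneg _),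
        Real.norm_of_nonneg (Real.log_natCast_nonneg _)]
      have : ((2 * m M + 3 : ℕ) : ℝ) ≤ ((2 * m M + 1 : ℕ) : ℝ) ^ 2 := by
        norm_cast
        nlinarith
      calc _ ≤ Real.log (((2 * m M + 1 : ℕ) : ℝ) ^ 2) := Real.log_le_log (by positivity) this
        _ = _ := by rw [Real.log_pow]; norm_num
  have hPO : (fun M => ((b M * r M : ℕ) : ℝ)) =O[atTop]
      fun M => g (2 * m M + 1) * Real.log ((2 * m M + 1 : ℕ) : ℝ) := by
    refine IsBigO.trans ?_ (hf'.mul hl')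
    refine IsBigO.of_bound (1 / Real.log 2) (Eventually.of_forall fun M => ?_)
    have h2 : 0 < Real.log 2 := Real.log_pos one_lt_two
    rw [Real.norm_of_nonneg (by positivity), div_mul_eq_mul_div, le_div_iff₀ h2, one_mul]
    exact (hle M).trans (le_abs_self _)
  refine isLittleO_irrefl (f'' := fun M => ((b M * r M : ℕ) : ℝ)) ?_ (hPO.trans_isLittleO hlit)
  refine (eventually_gt_atTop 0).frequently.mono fun M hM => ?_
  exact_mod_cast (hP M hM).ne'

/-! ### The three separations -/

theorem one_isBigO_log : (fun _ : ℕ => (1 : ℝ)) =O[atTop] fun n : ℕ => Real.log n :=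
  (isLittleO_const_left.2 (Or.inr (tendsto_norm_atTop_atTop.comp
    (Real.tendsto_log_atTop.comp tendsto_natCast_atTop_atTop)))).isBigO

theorem log_isLittleO_sqrt : (fun n : ℕ => Real.log n) =o[atTop] fun n : ℕ => Real.sqrt n := by
  have h := (isLittleO_log_rpow_atTop (r := 1 / 2) (by norm_num)).comp_tendsto
    (tendsto_natCast_atTop_atTop (R := ℝ))
  simpa only [Function.comp_def, Real.sqrt_eq_rpow] using h

theorem sqrt_isBigO_self : (fun n : ℕ => Real.sqrt n) =O[atTop] fun n : ℕ => (n : ℝ) := by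
  refine IsBigO.of_bound 1 (Eventually.of_forall fun n => ?_)
  rw [Real.norm_of_nonneg (Real.sqrt_nonneg _), Real.norm_of_nonneg (Nat.cast_nonneg _), one_mul]
  refine Real.sqrt_le_iff.2 ⟨Nat.cast_nonneg _, ?_⟩
  exact_mod_cast Nat.le_self_pow two_ne_zero n

theorem affine_mem_bigO {g : ℕ → ℝ} (hg : (fun _ => (1 : ℝ)) =O[atTop] g) {f : ℕ → ℕ}
    (hf : f ∈ bigO g) (c d : ℕ) : (fun n => c * f n + d) ∈ bigO g := by
  have h : (fun n => (c : ℝ) * (f n : ℝ) + (d : ℝ)) =O[atTop] g :=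
    (IsBigO.const_mul_left hf _).add ((isBigO_const_const (d : ℝ) one_ne_zero atTop).trans hg)
  simpa [bigO] using h

theorem natLog_mem_bigO : Nat.log 2 ∈ bigO fun n => Real.log n := by
  refine IsBigO.of_bound (1 / Real.log 2) (Eventually.of_forall fun n => ?_)
  have h2 : 0 < Real.log 2 := Real.log_pos one_lt_two
  rw [Real.norm_of_nonneg (Nat.cast_nonneg _), Real.norm_of_nonneg (Real.log_natCast_nonneg _),
    div_mul_eq_mul_div, one_mul]
  exact_mod_cast Real.natLog_le_logb n 2

theorem natSqrt_mem_bigO : Nat.sqrt ∈ bigO fun n => Real.sqrt n := by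
  refine IsBigO.of_bound 1 (Eventually.of_forall fun n => ?_)
  rw [Real.norm_of_nonneg (Nat.cast_nonneg _), Real.norm_of_nonneg (Real.sqrt_nonneg _), one_mul]
  exact Real.nat_sqrt_le_real_sqrt

theorem sparse_always_mem_log (spell : Letter → S) :
    sparseLanguage (fun _ => true) spell ∈ revPWKFamily S fun n => Real.log n := by
  refine sparseLanguage_mem (affine_mem_bigO one_isBigO_log natLog_mem_bigO 2 2) fun β m h => ?_
  have h₁ := marks_le_of_sparse_always h m le_rfl
  have h₂ : marks β m ≤ Nat.log 2 (2 * m + 1) :=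
    Nat.le_log_of_pow_le one_lt_two (h₁.trans (by omega))
  omega

theorem sparse_id_mem_sqrt (spell : Letter → S) :
    sparseLanguage id spell ∈ revPWKFamily S fun n => Real.sqrt n := by
  refine sparseLanguage_mem (affine_mem_bigO
    (one_isBigO_log.trans log_isLittleO_sqrt.isBigO) natSqrt_mem_bigO 2 4) fun β m h => ?_
  have h₁ := marks_le_of_sparse_id h m le_rfl
  have h₂ : marks β m - 1 ≤ Nat.sqrt (2 * m + 1) := by
    rw [Nat.le_sqrt]
    cases hB : marks β m with
    | zero => simp
    | succ B => rw [hB] at h₁; simp only [Nat.add_sub_cancel]; nlinarith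
  omega

theorem sparse_never_mem_linear (spell : Letter → S) :
    sparseLanguage (fun _ => false) spell ∈ revPWKFamily S fun n => (n : ℝ) := by
  refine sparseLanguage_mem (f := fun n => n + 1) ?_ fun β m _ => ?_
  · have := affine_mem_bigO (g := fun n => (n : ℝ))
      ((one_isBigO_log.trans log_isLittleO_sqrt.isBigO).trans sqrt_isBigO_self)
      (f := fun n => n) (isBigO_refl _ _) 1 1
    simpa using this
  · have : marks β m ≤ m := Nat.count_le _
    omega

theorem sparse_always_not_mem_const {spell : Letter → S} (hs : Function.Injective spell) :
    sparseLanguage (fun _ => true) spell ∉ revPWKFamily S fun _ => 1 := by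
  -- The windows have width `2 ^ M` and start at the positions `4 ^ i * 2 ^ M`.
  have ho : ∀ M i : ℕ, 2 * (4 ^ i * 2 ^ M + 2 ^ M) ≤ 4 ^ (i + 1) * 2 ^ M := by
    intro M i
    have h4 : 1 ≤ 4 ^ i := Nat.one_le_pow _ _ (by norm_num)
    have := Nat.mul_le_mul_right (2 ^ M) h4
    rw [pow_succ]
    nlinarith
  refine not_mem_family hs (isBigO_refl _ _) (fun M i => 4 ^ i * 2 ^ M) id id
    (fun M => 4 ^ M * 2 ^ M) (fun M i => ?_) (fun M i hi => ?_)
    (fun M k => sparse_always_pattern (ho M) k) ?_ (fun M hM => Nat.mul_pos hM hM) ?_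
  · have := ho M i
    simp only [id]
    omega
  · have h₁ := ho M i
    have h₂ : 4 ^ (i + 1) * 2 ^ M ≤ 4 ^ M * 2 ^ M :=
      Nat.mul_le_mul_right _ (Nat.pow_le_pow_right (by norm_num) hi)
    simp only [id]
    omega
  · refine tendsto_atTop_mono (fun M => ?_) tendsto_id
    exact Nat.lt_two_pow_self.le.trans (Nat.le_mul_of_pos_left _ (by positivity))
  · have h₁ : (fun M : ℕ => (1 : ℝ) * Real.log ((2 * (4 ^ M * 2 ^ M) + 1 : ℕ) : ℝ)) =O[atTop]
        fun M : ℕ => (M : ℝ) := by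
      refine IsBigO.of_bound (2 * Real.log 8) ?_
      filter_upwards [eventually_ge_atTop 1] with M hM
      rw [one_mul, Real.norm_of_nonneg (Real.log_natCast_nonneg _),
        Real.norm_of_nonneg (Nat.cast_nonneg _)]
      have h8 : 2 * (4 ^ M * 2 ^ M) + 1 ≤ 8 ^ (2 * M) := by
        rw [← mul_pow, two_mul M, pow_add]
        have : 8 ^ 1 ≤ 8 ^ M := Nat.pow_le_pow_right (by norm_num) hM
        norm_num at this ⊢
        nlinarith
      calc _ ≤ Real.log ((8 ^ (2 * M) : ℕ) : ℝ) :=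
            Real.log_le_log (by positivity) (by exact_mod_cast h8)
        _ = _ := by push_cast; rw [Real.log_pow]; push_cast; ring
    have h₂ : (fun M : ℕ => (M : ℝ)) =o[atTop] fun M : ℕ => ((id M * id M : ℕ) : ℝ) := by
      have := (isLittleO_pow_pow_atTop_of_lt (𝕜 := ℝ) (show 1 < 2 by norm_num)).comp_tendsto
        (tendsto_natCast_atTop_atTop (R := ℝ))
      simpa [Function.comp_def, pow_two] using this
    exact h₁.trans_isLittleO h₂

theorem sparse_id_not_mem_log {spell : Letter → S} (hs : Function.Injective spell) :
    sparseLanguage id spell ∉ revPWKFamily S fun n => Real.log n := by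
  -- The windows have width `2` and start at the positions `i * (M + 4)`.
  refine not_mem_family hs one_isBigO_log (fun M i => i * (M + 4)) id (fun _ => 1)
    (fun M => M * (M + 4)) (fun M i => ?_) (fun M i hi => ?_)
    (fun M k => sparse_id_pattern (fun i => ?_) k) ?_ (fun M hM => by simpa using hM) ?_
  · rw [add_one_mul]; omega
  · have : (i + 1) * (M + 4) ≤ M * (M + 4) := Nat.mul_le_mul_right _ hi
    rw [add_one_mul] at this
    omega
  · simp only [id]; rw [add_one_mul]; omega
  · exact tendsto_atTop_mono (fun M => Nat.le_mul_of_pos_right _ (by omega)) tendsto_id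
  · have h₁ : (fun M : ℕ => Real.log ((2 * (M * (M + 4)) + 1 : ℕ) : ℝ)) =O[atTop]
        fun M : ℕ => Real.log M := by
      refine IsBigO.of_bound 3 ?_
      filter_upwards [eventually_ge_atTop 5] with M hM
      rw [Real.norm_of_nonneg (Real.log_natCast_nonneg _),
        Real.norm_of_nonneg (Real.log_natCast_nonneg _)]
      have h3 : 2 * (M * (M + 4)) + 1 ≤ M ^ 3 := by
        obtain ⟨k, rfl⟩ := Nat.exists_eq_add_of_le hM
        ring_nf
        nlinarith [Nat.zero_le (k ^ 3), Nat.zero_le (k ^ 2)]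
      calc _ ≤ Real.log ((M ^ 3 : ℕ) : ℝ) :=
            Real.log_le_log (by positivity) (by exact_mod_cast h3)
        _ = _ := by push_cast; rw [Real.log_pow]; norm_num
    have h₂ : (fun M : ℕ => Real.log M * Real.log M) =o[atTop] fun M : ℕ => (M : ℝ) := by
      have := (Real.isLittleO_pow_log_id_atTop (n := 2)).comp_tendsto
        (tendsto_natCast_atTop_atTop (R := ℝ))
      simpa [Function.comp_def, pow_two] using this
    simpa using (h₁.mul h₁).trans_isLittleO h₂

theorem sparse_never_not_mem_sqrt {spell : Letter → S} (hs : Function.Injective spell) :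
    sparseLanguage (fun _ => false) spell ∉ revPWKFamily S fun n => Real.sqrt n := by
  refine not_mem_family hs (one_isBigO_log.trans log_isLittleO_sqrt.isBigO)
    (fun _ i => 2 * i) id (fun _ => 1) (fun M => 2 * M) (fun M i => ?_) (fun M i hi => ?_)
    (fun M k => sparse_never _ _) ?_ (fun M hM => by simpa using hM) ?_
  · omega
  · simp only [id] at hi ⊢; omega
  · exact tendsto_atTop_mono (fun M => by simp only [id]; omega) tendsto_id
  · have hn : Tendsto (fun M : ℕ => 2 * (2 * M) + 1) atTop atTop :=
      tendsto_atTop_mono (fun M => by simp only [id]; omega) tendsto_id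
    have h₁ : (fun n : ℕ => Real.sqrt n * Real.log n) =o[atTop] fun n : ℕ => (n : ℝ) := by
      have := (isBigO_refl (fun n : ℕ => Real.sqrt n) atTop).mul_isLittleO log_isLittleO_sqrt
      simpa only [Real.mul_self_sqrt (Nat.cast_nonneg _)] using this
    have h₂ : (fun M : ℕ => ((2 * (2 * M) + 1 : ℕ) : ℝ)) =O[atTop]
        fun M : ℕ => ((1 * id M : ℕ) : ℝ) := by
      refine IsBigO.of_bound 5 ?_
      filter_upwards [eventually_ge_atTop 1] with M hM
      rw [Real.norm_of_nonneg (Nat.cast_nonneg _), Real.norm_of_nonneg (Nat.cast_nonneg _)]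
      have : 2 * (2 * M) + 1 ≤ 5 * (1 * id M) := by simp only [id]; omega
      exact_mod_cast this
    exact (h₁.comp_tendsto hn).trans_isBigO h₂

end WatsonCrick

theorem mainTheorem7 (S : Type*) [Infinite S] :
    WatsonCrick.revPWKFamily S (fun _ => 1) ⊂
      WatsonCrick.revPWKFamily S (fun n => Real.log n) ∧
    WatsonCrick.revPWKFamily S (fun n => Real.log n) ⊂
      WatsonCrick.revPWKFamily S (fun n => Real.sqrt n) ∧
    WatsonCrick.revPWKFamily S (fun n => Real.sqrt n) ⊂
      WatsonCrick.revPWKFamily S (fun n => n) := by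
  open WatsonCrick in
  obtain ⟨spell, hs⟩ : ∃ spell : Letter → S, Function.Injective spell := by
    obtain ⟨k, ⟨e⟩⟩ := Finite.exists_equiv_fin Letter
    exact ⟨_, ((Infinite.natEmbedding S).injective.comp Fin.val_injective).comp e.injective⟩
  exact ⟨(Set.ssubset_iff_of_subset (revPWKFamily_mono one_isBigO_log)).2
      ⟨_, sparse_always_mem_log spell, sparse_always_not_mem_const hs⟩,
    (Set.ssubset_iff_of_subset (revPWKFamily_mono log_isLittleO_sqrt.isBigO)).2
      ⟨_, sparse_id_mem_sqrt spell, sparse_id_not_mem_log hs⟩,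
    (Set.ssubset_iff_of_subset (revPWKFamily_mono sqrt_isBigO_self)).2
      ⟨_, sparse_never_mem_linear spell, sparse_never_not_mem_sqrt hs⟩⟩
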